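/- **Setting and notation.** Let $G$ be a second-countable locally compact Hausdorff group, $\Gamma<G$ a lattice, $Y=\Gamma\backslash G$, $\mathrm{pr}\colon G\to Y$ the projection and $m$ the $G$-invariant Borel probability measure on $Y$. Denote also by $m$ the Haar measure on $G$ that induces $m$ on $Y$, i.e. $m(E)=\int_Y \#\big(E\cap \mathrm{pr}^{-1}(y)\big)\,\mathrm{d}m(y)$ for every Borel set $E\subseteq G$. Let $K<G$ be a compact subgroup whose normalizer $N_G(K)$ is open in $G$, let $X=Y/K$, and let $\mathcal X$ be the Borel $\sigma$-algebra of $X$ pulled back to $Y$. For $y\in Y$ and $F\subseteq G$ put $yF=\{yf^{-1}\mid f\in F\}$. Fix $a\in G$. Let $U$ be the Koopman operator $Uf(y)=f(ya^{-1})$ on $L^2(Y,m)$, $L^2(X)\subseteq L^2(Y,m)$ the subspace of $\mathcal X$-measurable functions, $P_X$ the orthogonal projection onto $L^2(X)$, $T=P_XUP_X$ the averaging operator and $L^2_0(X)$ the orthogonal complement of the constants in $L^2(X)$. Assume that $\lambda:=\|T\|_{L^2_0(X)}$ satisfies $0<\lambda<1$, and write $\lambda^{\mathbb N}=\{\lambda^k\mid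 k\in\mathbb Z,\ k\ge1\}$. Assume *property (M)*: there is a closed subspace $\mathcal M\subseteq L^2(Y,m)$ with $L^2(X)\subseteq\mathcal M$, $U\mathcal M\subseteq\mathcal M$, stable under multiplication by $L^\infty(X)$, such that $P_XUP_Xf=P_XUf$ for all $f\in\mathcal M$. All identity neighborhoods below are Borel. For an identity neighborhood $B$ and integers $s\le t$ let $B^{(s,t)}=\bigcap_{s\le i\le t}a^{-i}Ba^i$. For $h\geq 0$, $B$ is *$(a,h)$-homogeneous* with constant $C_{B,h}>0$ if $m(B^{(s,t)})\ge C_{B,h}\,e^{-h(t-s+1)}$ for all integers $s\le0\le t$. For $\varphi\colon Y\to[0,1]$ let $\varphi^{B}(y)=\operatorname{ess\,sup}_{b\in B}\varphi(yb)$ and $\varphi_{B}(y)=\operatorname{ess\,inf}_{b\in B}\varphi(yb)$, with respect to Haar measure. For a measure $\nu$ write $\nu(\varphi)=\int\varphi\,\mathrm{d}\nu$. For $\eta,\beta\in(0,1)$ let $D(\eta\,\|\,\beta)=-\eta\log\frac{\beta}{\eta}-(1-\eta)\log\frac{1-\beta}{1-\eta}$. **Theorem.** Let $B\subset G$ be an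 identity neighborhood, $\Omega\subset Y$ compact, and $\mu$ an $a$-invariant Borel probability measure on $Y$. Let $s\le0\le t$ be two distinct integers, $n=t-s+1$, and $$\alpha:=-\frac1n\log\int_\Omega\mu\big(yB^{(s,t)}\big)\,\mathrm{d}\mu(y).$$ Let $h>0$ and let $B_0\subset N_G(K)$ be an identity neighborhood such that 1. $B_0$ is $(a,h)$-homogeneous with constant $C_{B_0,h}$; 2. $B_0^{-1}B_0\subseteq B$; 3. for every $x\in G$ with $\mathrm{pr}(x)\in\Omega$, $\mathrm{pr}$ is injective on $\{xb^{-1}\mid b\in B_0\}$. Let $\varphi\colon Y\to[0,1]$ be $\mathcal X$-measurable. (a) If $\varphi$ is lower-semicontinuous and $1>\mu(\varphi)\ge m(\varphi^{B_0})$, then for all $\kappa$ and all $\theta\in\lambda^{\mathbb N}$ with $$\mu(\Omega)>\kappa\ge\frac{1-\mu(\varphi)}{1-m(\varphi^{B_0})},\qquad \theta\le\frac{[\mu(\varphi)-(1-\kappa)]/\kappa-m(\varphi^{B_0})}{1-m(\varphi^{B_0})}$$ we have $$\frac{D\big([\mu(\varphi)-(1-\kappa)]/\kappa\,\big\|\,\theta+(1-\theta)m(\varphi^{B_0})\big)}{-\log\theta}\le\frac{h-\alpha}{-\log\lambda}+\frac1{n(-\log\lambda)}\Big[\log\frac{\log\theta}{\log\lambda}+D\big(\mu(\varphi)\,\|\,m(\varphi^{B_0})\big)-2\log\frac{\mu(\Omega)-\kappa}2-\log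 C_{B_0,h}\Big].$$ (b) If $\varphi$ is upper-semicontinuous and $0<\mu(\varphi)\le m(\varphi_{B_0})$, then for all $\kappa$ and all $\theta\in\lambda^{\mathbb N}$ with $$\mu(\Omega)>\kappa\ge\frac{\mu(\varphi)}{m(\varphi_{B_0})},\qquad \theta\le\frac{m(\varphi_{B_0})-\mu(\varphi)/\kappa}{m(\varphi_{B_0})}$$ we have $$\frac{D\big(\mu(\varphi)/\kappa\,\big\|\,(1-\theta)m(\varphi_{B_0})\big)}{-\log\theta}\le\frac{h-\alpha}{-\log\lambda}+\frac1{n(-\log\lambda)}\Big[\log\frac{\log\theta}{\log\lambda}+D\big(\mu(\varphi)\,\|\,m(\varphi_{B_0})\big)-2\log\frac{\mu(\Omega)-\kappa}2-\log C_{B_0,h}\Big].$$ -/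

import Mathlib

open MeasureTheory Set Topology
open scoped ENNReal

/-! ### Averaging operators and property (M) for a general dynamical system -/

section Averaging

variable {Y : Type*} {mX mY : MeasurableSpace Y} {m : Measure Y}

/-- The Koopman operator `f ↦ f ∘ S` on `L²(Y, m)`. -/
noncomputable def koopman {S : Y → Y} (hS : MeasurePreserving S m m) :
    Lp ℂ 2 m →L[ℂ] Lp ℂ 2 m :=
  (Lp.compMeasurePreservingₗᵢ ℂ S hS).toContinuousLinearMap

/-- The orthogonal projection of `L²(Y, m)` onto `L²(X)`, the subspace of the functions that are
measurable (up to null sets) for the sub-σ-algebra `mX`. -/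
noncomputable def projX (hX : mX ≤ mY) :
    Lp ℂ 2 m →L[ℂ] Lp ℂ 2 m :=
  (lpMeas ℂ ℂ mX 2 m).subtypeL ∘L condExpL2 ℂ ℂ hX

/-- The averaging operator `T = P U P` on `L²(Y, m)`. -/
noncomputable def averagingOp {S : Y → Y} (hS : MeasurePreserving S m m) (hX : mX ≤ mY) : Lp ℂ 2 m →L[ℂ] Lp ℂ 2 m :=
  projX hX ∘L koopman hS ∘L projX hX

/-- `L²₀(X)`: the functions of `L²(X)` that are orthogonal to the constants. -/
noncomputable def L20 (mX : MeasurableSpace Y) {mY : MeasurableSpace Y} (m : Measure Y)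
    [IsFiniteMeasure m] :
    Submodule ℂ (Lp ℂ 2 m) :=
  lpMeas ℂ ℂ mX 2 m ⊓ (Submodule.span ℂ {Lp.const 2 m (1 : ℂ)})ᗮ

/-- The operator norm of the averaging operator on `L²₀(X)`. -/
noncomputable def averagingNorm [IsFiniteMeasure m] {S : Y → Y} (hS : MeasurePreserving S m m) (hX : mX ≤ mY) : ℝ :=
  ‖averagingOp hS hX ∘L (L20 mX m).subtypeL‖

/-- Property (M): there is a closed subspace `M` of `L²(Y)`, stable under the Koopman operator and
under multiplication by bounded `mX`-measurable functions, which contains `L²(X)` and on which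
`P U P = P U`. -/
def HasPropertyM {S : Y → Y} (hS : MeasurePreserving S m m) (hX : mX ≤ mY) : Prop :=
  ∃ M : Submodule ℂ (Lp ℂ 2 m),
    IsClosed (M : Set (Lp ℂ 2 m)) ∧
    (∀ f ∈ M, koopman hS f ∈ M) ∧
    (∀ g : Y → ℂ, Measurable[mX] g → (∃ c : ℝ, ∀ y, ‖g y‖ ≤ c) →
      ∀ f ∈ M, ∀ f' : Lp ℂ 2 m, (f' =ᵐ[m] fun y => g y * f y) → f' ∈ M) ∧
    lpMeas ℂ ℂ mX 2 m ≤ M ∧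
    ∀ f ∈ M, projX hX (koopman hS (projX hX f)) = projX hX (koopman hS f)

end Averaging

/-! ### The homogeneous space `Γ \ G` and the state space `Γ \ G / K` -/

/-- The space `Γ \ G` of cosets `Γ g`: the quotient of `G` by left multiplication by `Γ`. -/
def CosetSpace {G : Type*} [Group G] (Γ : Subgroup G) : Type _ :=
  Quotient (MulAction.orbitRel Γ G)

namespace CosetSpace

variable {G : Type*} [Group G] {Γ : Subgroup G}

/-- The projection `G → Γ \ G`, `g ↦ Γ g`. -/
def mk (Γ : Subgroup G) (g : G) : CosetSpace Γ :=
  Quotient.mk (MulAction.orbitRel Γ G) g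

theorem mk_eq_mk_iff {x x' : G} : mk Γ x = mk Γ x' ↔ ∃ γ ∈ Γ, γ * x' = x := by
  refine (Quotient.eq (r := MulAction.orbitRel Γ G)).trans ?_
  constructor
  · rintro ⟨⟨γ, hγ⟩, h⟩
    exact ⟨γ, hγ, h⟩
  · rintro ⟨γ, hγ, h⟩
    exact ⟨⟨γ, hγ⟩, h⟩

/-- Right translation on `Γ \ G`: `(Γ x).mul g = Γ (x * g)`. -/
def mul (y : CosetSpace Γ) (g : G) : CosetSpace Γ :=
  Quotient.lift (fun x => mk Γ (x * g)) (by
    intro x x' h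
    obtain ⟨γ, hγ, h⟩ := mk_eq_mk_iff.1 (Quotient.sound h : mk Γ x = mk Γ x')
    exact mk_eq_mk_iff.2 ⟨γ, hγ, by rw [← h, mul_assoc]⟩) y

theorem mk_mul (x g : G) : (mk Γ x).mul g = mk Γ (x * g) := rfl

theorem mul_one (y : CosetSpace Γ) : y.mul 1 = y := by
  induction y using Quotient.inductionOn with
  | h x => exact congrArg (mk Γ) (_root_.mul_one x)

theorem mul_mul (y : CosetSpace Γ) (g g' : G) : (y.mul g).mul g' = y.mul (g * g') := by
  induction y using Quotient.inductionOn with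
  | h x => exact congrArg (mk Γ) (mul_assoc x g g')

/-- For a set `F` in `G` and a point `y`, the set `y F = {y f⁻¹ | f ∈ F}` (the convention of the
right action by inverses). -/
def mulSet (y : CosetSpace Γ) (F : Set G) : Set (CosetSpace Γ) :=
  (fun f => y.mul f⁻¹) '' F

instance [TopologicalSpace G] : TopologicalSpace (CosetSpace Γ) :=
  inferInstanceAs (TopologicalSpace (Quotient (MulAction.orbitRel Γ G)))

instance [TopologicalSpace G] : MeasurableSpace (CosetSpace Γ) := borel _

instance [TopologicalSpace G] : BorelSpace (CosetSpace Γ) := ⟨rfl⟩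

/-- The equivalence relation on `Γ \ G` whose classes are the orbits `y K`. -/
def stateSetoid (Γ K : Subgroup G) : Setoid (CosetSpace Γ) where
  r y y' := ∃ k ∈ K, y.mul k = y'
  iseqv :=
    { refl := fun y => ⟨1, K.one_mem, y.mul_one⟩
      symm := by
        rintro y y' ⟨k, hk, rfl⟩
        exact ⟨k⁻¹, K.inv_mem hk, by rw [mul_mul, mul_inv_cancel, mul_one]⟩
      trans := by
        rintro y y' y'' ⟨k, hk, rfl⟩ ⟨k', hk', rfl⟩
        exact ⟨k * k', K.mul_mem hk hk', by rw [mul_mul]⟩ }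

end CosetSpace

/-- The state space `X = (Γ \ G) / K`, with the quotient topology. -/
def StateSpace {G : Type*} [Group G] (Γ K : Subgroup G) : Type _ :=
  Quotient (CosetSpace.stateSetoid Γ K)

instance {G : Type*} [Group G] [TopologicalSpace G] (Γ K : Subgroup G) :
    TopologicalSpace (StateSpace Γ K) :=
  inferInstanceAs (TopologicalSpace (Quotient (CosetSpace.stateSetoid Γ K)))

/-- The projection `Γ \ G → X`. -/
def StateSpace.mk {G : Type*} [Group G] (Γ K : Subgroup G) (y : CosetSpace Γ) : StateSpace Γ K :=
  Quotient.mk (CosetSpace.stateSetoid Γ K) y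

/-- The Borel σ-algebra of `X`, pulled back to a sub-σ-algebra of the one of `Γ \ G`. -/
@[reducible] def stateAlgebra {G : Type*} [Group G] [TopologicalSpace G] (Γ K : Subgroup G) :
    MeasurableSpace (CosetSpace Γ) :=
  (borel (StateSpace Γ K)).comap (StateSpace.mk Γ K)

theorem stateAlgebra_le {G : Type*} [Group G] [TopologicalSpace G] (Γ K : Subgroup G) :
    stateAlgebra Γ K ≤ (inferInstance : MeasurableSpace (CosetSpace Γ)) := by
  let _ : MeasurableSpace (StateSpace Γ K) := borel _
  have : BorelSpace (StateSpace Γ K) := ⟨rfl⟩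
  have hc : Continuous (StateSpace.mk Γ K) := continuous_quot_mk
  exact measurable_iff_comap_le.1 hc.measurable

/-- The Haar measure `mG` of `G` is normalized so that it induces the measure `m` on `Γ \ G`
(Weil's formula): for every Borel set `E` of `G`, the measure of `E` is the integral over
`y ∈ Γ \ G` of the number of points of `E` in the fibre over `y`. -/
def InducesQuotientMeasure {G : Type*} [Group G] [TopologicalSpace G] [MeasurableSpace G]
    {Γ : Subgroup G} (mG : Measure G) (m : Measure (CosetSpace Γ)) : Prop :=
  ∀ E : Set G, MeasurableSet E →
    mG E = ∫⁻ y, ((E ∩ CosetSpace.mk Γ ⁻¹' {y}).encard : ℝ≥0∞) ∂m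

/-! ### Bowen balls, homogeneity, essential suprema -/

/-- The Bowen ball `⋂ s ≤ i ≤ t, a^(-i) B a^i`. -/
def bowenBall {G : Type*} [Group G] (a : G) (B : Set G) (s t : ℤ) : Set G :=
  ⋂ i ∈ Set.Icc s t, (fun b => a ^ (-i) * b * a ^ i) '' B

/-- `B` is `(a, h)`-homogeneous for the Haar measure `mG`, with constant `C = C_{B,h}`. -/
def IsHomogeneousWith {G : Type*} [Group G] [MeasurableSpace G] (mG : Measure G)
    (a : G) (h : ℝ) (B : Set G) (C : ℝ) : Prop :=
  0 < C ∧ ∀ s t : ℤ, s ≤ 0 → 0 ≤ t →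
    ENNReal.ofReal (C * Real.exp (-h * ((t : ℝ) - s + 1))) ≤ mG (bowenBall a B s t)

/-- `φ^B (y)`, the essential supremum of `φ (y b)` over `b ∈ B`. -/
noncomputable def upperEnvelope {G : Type*} [Group G] [MeasurableSpace G] {Γ : Subgroup G}
    (mG : Measure G) (B : Set G) (φ : CosetSpace Γ → ℝ) (y : CosetSpace Γ) : ℝ :=
  essSup (fun b : G => φ (y.mul b)) (mG.restrict B)

/-- `φ_B (y)`, the essential infimum of `φ (y b)` over `b ∈ B`. -/
noncomputable def lowerEnvelope {G : Type*} [Group G] [MeasurableSpace G] {Γ : Subgroup G}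
    (mG : Measure G) (B : Set G) (φ : CosetSpace Γ → ℝ) (y : CosetSpace Γ) : ℝ :=
  essInf (fun b : G => φ (y.mul b)) (mG.restrict B)

/-- `α = -(1/n) log ∫_Ω μ (y B^(s,t)) dμ(y)` with `n = t - s + 1`. -/
noncomputable def bowenRate {G : Type*} [Group G] [TopologicalSpace G] {Γ : Subgroup G}
    (μ : Measure (CosetSpace Γ)) (a : G) (B : Set G) (Ω : Set (CosetSpace Γ)) (s t : ℤ) : ℝ :=
  -(1 / ((t : ℝ) - s + 1)) *
    Real.log (∫⁻ y in Ω, μ (y.mulSet (bowenBall a B s t)) ∂μ).toReal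

/-- The Kullback–Leibler divergence `D(η ‖ β)` of the two-point distributions `(η, 1 - η)` and
`(β, 1 - β)`, for `η, β ∈ (0, 1)`. -/
noncomputable def klTwo (η β : ℝ) : ℝ :=
  -η * Real.log (β / η) - (1 - η) * Real.log ((1 - β) / (1 - η))

/-! The quantity `m Z` is estimated in two ways, where `Z` is the set of orbits along which the
average of `ψ = φ^{B₀}` is at least `η = (μ(φ) - (1 - κ)) / κ`.

From below, by packing. Time averages of `φ` have `μ`-mean `μ(φ)`, so they are at least `η` off a
set of `μ`-measure at most `κ`, leaving mass `δ = μ(Ω) - κ` in `Ω`. Markov's inequality discards the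
points where `μ(y B^{(s,t)})` is large compared with its integral `I = e^{-αn}`. A maximal family of
disjoint sets `y B₀^{(s,t)}` based at the remaining points is then numerous, because `B₀⁻¹ B₀ ⊆ B`
makes the sets `y B^{(s,t)}` cover those points. Each member has Haar measure at least `C e^{-hn}`
and embeds in a translate of `Z`. This gives `(δ/2)² C e^{-hn} ≤ I · m(Z)`
(`sq_mul_exp_le_of_lowerSemicontinuous`).

From above, by large deviations. Put `θ = λ^k` and let `V` be multiplication by `e^{rψ/2}`. Property
(M) turns the exponential moment of `ψ` along steps of length `k` into a matrix coefficient of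
powers of `V T^k V`. Since `T^k` fixes constants and contracts `L²₀(X)` by `θ`, it is dominated by
`θ · id + (1 - θ) · (projection to constants)`, and a weighted Cauchy-Schwarz inequality bounds `V
T^k V` by `1 - q + q e^r` with `q = θ + (1 - θ) m(ψ)` (`mixingForm_mulOp_le`,
`integral_exp_sum_le`). Thus the sums deviate no more than those of independent Bernoulli(`q`)
variables. Chernoff's bound, with a union over the `k` residue classes, gives `m(Z) ≤ k e^{-(n/k -
1) D(η‖q)}` (`measureReal_orbit_sum_ge_le`).

Taking logarithms and comparing proves (a); the surplus `D(η‖q)` is at most `D(μ(φ)‖m(ψ))` by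
monotonicity. Part (b) is (a) applied to `1 - φ`. -/

/-! ### Multiplication operators and the conditional expectation on `L²` -/

section AveragingLemmas

variable {Y : Type*} {mX mY : MeasurableSpace Y} {m : Measure Y}

/-- Multiplication by a bounded real function is a bounded operator on `L²`. -/
theorem exists_mulOp (w : Y → ℝ) (hw : Measurable w) (c : ℝ) (hc : ∀ y, |w y| ≤ c) :
    ∃ W : Lp ℂ 2 m →L[ℂ] Lp ℂ 2 m, ∀ f, W f =ᵐ[m] fun y => (w y : ℂ) * f y := by
  have hm : MemLp (fun y => (w y : ℂ)) ∞ m :=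
    memLp_top_of_bound (Complex.measurable_ofReal.comp hw).aestronglyMeasurable c
      (Filter.Eventually.of_forall fun y => by simpa using hc y)
  refine ⟨(ContinuousLinearMap.mul ℂ ℂ).holderL m ∞ 2 2 hm.toLp, fun f => ?_⟩
  filter_upwards [(ContinuousLinearMap.mul ℂ ℂ).coeFn_holder (r := 2) hm.toLp f, hm.coeFn_toLp]
    with y h1 h2
  rw [← h2]
  exact h1

theorem inner_mulOp {w : Y → ℝ} {W : Lp ℂ 2 m →L[ℂ] Lp ℂ 2 m}
    (hW : ∀ f, W f =ᵐ[m] fun y => (w y : ℂ) * f y) (f g : Lp ℂ 2 m) :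
    inner ℂ (W f) g = inner ℂ f (W g) := by
  rw [L2.inner_def, L2.inner_def]
  refine integral_congr_ae ?_
  filter_upwards [hW f, hW g] with y h1 h2
  simp only [h1, h2, RCLike.inner_apply, map_mul, Complex.conj_ofReal]
  ring

theorem mulOp_mem_lpMeas {w : Y → ℝ} (hw : Measurable[mX] w)
    {W : Lp ℂ 2 m →L[ℂ] Lp ℂ 2 m}
    (hW : ∀ f, W f =ᵐ[m] fun y => (w y : ℂ) * f y) {f : Lp ℂ 2 m}
    (hf : f ∈ lpMeas ℂ ℂ mX 2 m) : W f ∈ lpMeas ℂ ℂ mX 2 m := by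
  rw [mem_lpMeas_iff_aestronglyMeasurable] at hf ⊢
  have h1 : AEStronglyMeasurable[mX] (fun y => (w y : ℂ)) m :=
    (Complex.measurable_ofReal.comp hw).aestronglyMeasurable
  exact (h1.mul hf).congr (hW f).symm

theorem projX_mem (hX : mX ≤ mY) (f : Lp ℂ 2 m) : projX hX f ∈ lpMeas ℂ ℂ mX 2 m :=
  (condExpL2 ℂ ℂ hX f).2

theorem projX_eq_of_mem_of_inner (hX : mX ≤ mY) {u v : Lp ℂ 2 m}
    (hv : v ∈ lpMeas ℂ ℂ mX 2 m)
    (h : ∀ w ∈ lpMeas ℂ ℂ mX 2 m, inner ℂ (u - v) w = 0) : projX hX u = v := by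
  have : Fact (mX ≤ mY) := ⟨hX⟩
  exact Submodule.eq_starProjection_of_mem_of_inner_eq_zero hv h

theorem projX_of_mem (hX : mX ≤ mY) {v : Lp ℂ 2 m} (hv : v ∈ lpMeas ℂ ℂ mX 2 m) :
    projX hX v = v :=
  projX_eq_of_mem_of_inner hX hv fun w _ => by simp

theorem inner_sub_projX (hX : mX ≤ mY) (u : Lp ℂ 2 m) {w : Lp ℂ 2 m}
    (hw : w ∈ lpMeas ℂ ℂ mX 2 m) : inner ℂ (u - projX hX u) w = 0 := by
  have : Fact (mX ≤ mY) := ⟨hX⟩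
  exact Submodule.starProjection_inner_eq_zero u w hw

theorem inner_projX_left (hX : mX ≤ mY) (u : Lp ℂ 2 m) {w : Lp ℂ 2 m}
    (hw : w ∈ lpMeas ℂ ℂ mX 2 m) : inner ℂ (projX hX u) w = inner ℂ u w := by
  have := inner_sub_projX hX u hw
  rw [inner_sub_left, sub_eq_zero] at this
  exact this.symm

theorem inner_projX_right (hX : mX ≤ mY) (u : Lp ℂ 2 m) {w : Lp ℂ 2 m}
    (hw : w ∈ lpMeas ℂ ℂ mX 2 m) : inner ℂ w (projX hX u) = inner ℂ w u := by
  rw [← inner_conj_symm, inner_projX_left hX u hw, inner_conj_symm]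

/-- Multiplication by a real `mX`-measurable function is self-adjoint and preserves `L²(X)`, hence
also its orthogonal complement. -/
theorem projX_mulOp (hX : mX ≤ mY) {w : Y → ℝ} (hw : Measurable[mX] w)
    {W : Lp ℂ 2 m →L[ℂ] Lp ℂ 2 m}
    (hW : ∀ f, W f =ᵐ[m] fun y => (w y : ℂ) * f y) (f : Lp ℂ 2 m) :
    projX hX (W f) = W (projX hX f) := by
  refine projX_eq_of_mem_of_inner hX (mulOp_mem_lpMeas hw hW (projX_mem hX f)) fun g hg => ?_
  rw [← map_sub, inner_mulOp hW]
  exact inner_sub_projX hX f (mulOp_mem_lpMeas hw hW hg)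

/-! ### Powers of the averaging operator -/

theorem koopman_apply_ae {S : Y → Y} (hS : MeasurePreserving S m m) (f : Lp ℂ 2 m) :
    koopman hS f =ᵐ[m] fun y => f (S y) :=
  Lp.coeFn_compMeasurePreserving f hS

theorem koopman_pow_apply_ae {S : Y → Y} (hS : MeasurePreserving S m m) (k : ℕ) (f : Lp ℂ 2 m) :
    (koopman hS ^ k) f =ᵐ[m] fun y => f (S^[k] y) := by
  induction k with
  | zero => simp
  | succ k ih =>
    rw [pow_succ', Function.iterate_succ]
    have h1 := koopman_apply_ae hS ((koopman hS ^ k) f)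
    have h2 := hS.quasiMeasurePreserving.ae_eq_comp ih
    filter_upwards [h1, h2] with y h1 h2
    exact h1.trans h2

theorem inner_koopman {S : Y → Y} (hS : MeasurePreserving S m m) (f g : Lp ℂ 2 m) :
    inner ℂ (koopman hS f) (koopman hS g) = inner ℂ f g :=
  (Lp.compMeasurePreservingₗᵢ ℂ S hS).inner_map_map f g

theorem averagingOp_mem {S : Y → Y} (hS : MeasurePreserving S m m) (hX : mX ≤ mY)
    (f : Lp ℂ 2 m) : averagingOp hS hX f ∈ lpMeas ℂ ℂ mX 2 m :=
  projX_mem hX _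

theorem averagingOp_pow_mem {S : Y → Y} (hS : MeasurePreserving S m m) (hX : mX ≤ mY)
    (k : ℕ) {f : Lp ℂ 2 m} (hf : f ∈ lpMeas ℂ ℂ mX 2 m) :
    (averagingOp hS hX ^ k) f ∈ lpMeas ℂ ℂ mX 2 m := by
  cases k with
  | zero => simpa using hf
  | succ k => rw [pow_succ']; exact averagingOp_mem hS hX _

/-- On a subspace with property (M), projecting the Koopman powers gives the powers of the
averaging operator. -/
theorem projX_koopman_pow {S : Y → Y} (hS : MeasurePreserving S m m) (hX : mX ≤ mY)
    {M : Submodule ℂ (Lp ℂ 2 m)} (hMU : ∀ f ∈ M, koopman hS f ∈ M)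
    (hMP : ∀ f ∈ M, projX hX (koopman hS (projX hX f)) = projX hX (koopman hS f))
    (k : ℕ) {f : Lp ℂ 2 m} (hf : f ∈ M) :
    projX hX ((koopman hS ^ (k + 1)) f) = (averagingOp hS hX ^ (k + 1)) (projX hX f) := by
  have hMk : ∀ k : ℕ, (koopman hS ^ k) f ∈ M := by
    intro k
    induction k with
    | zero => simpa using hf
    | succ k ih => rw [pow_succ']; exact hMU _ ih
  have key : ∀ k : ℕ, projX hX ((koopman hS ^ k) f) = (averagingOp hS hX ^ k) (projX hX f) := by
    intro k
    induction k with
    | zero => simp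
    | succ k ih =>
      rw [pow_succ', pow_succ']
      change projX hX (koopman hS ((koopman hS ^ k) f)) =
        averagingOp hS hX ((averagingOp hS hX ^ k) (projX hX f))
      -- `U^k f` need not lie in `L²(X)`, but it lies in `M`, and there a projection may be inserted
      -- before the last `U`.
      rw [← hMP _ (hMk k), ih]
      change _ = projX hX (koopman hS (projX hX _))
      rw [projX_of_mem hX (averagingOp_pow_mem hS hX k (projX_mem hX f))]
  exact key _

/-! ### Contraction on `L²₀(X)` and the quadratic form dominating `T ^ k` -/

section Prob

variable [IsProbabilityMeasure m]

theorem const_one_mem : (Lp.const 2 m (1 : ℂ)) ∈ lpMeas ℂ ℂ mX 2 m := by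
  rw [mem_lpMeas_iff_aestronglyMeasurable]
  exact (aestronglyMeasurable_const (b := (1 : ℂ))).congr (Lp.coeFn_const 2 m (1 : ℂ)).symm

theorem norm_const_one : ‖Lp.const 2 m (1 : ℂ)‖ = 1 := by
  rw [Lp.norm_const]
  · simp
  · exact two_ne_zero

theorem koopman_const_one {S : Y → Y} (hS : MeasurePreserving S m m) :
    koopman hS (Lp.const 2 m (1 : ℂ)) = Lp.const 2 m (1 : ℂ) := by
  refine Lp.ext ?_
  have h := Lp.coeFn_const 2 m (1 : ℂ)
  filter_upwards [koopman_apply_ae hS (Lp.const 2 m (1 : ℂ)), h,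
    hS.quasiMeasurePreserving.ae_eq_comp h] with y h1 h2 h3
  rw [h1, h2]
  exact h3

theorem averagingOp_const_one {S : Y → Y} (hS : MeasurePreserving S m m) (hX : mX ≤ mY) :
    averagingOp hS hX (Lp.const 2 m (1 : ℂ)) = Lp.const 2 m (1 : ℂ) := by
  change projX hX (koopman hS (projX hX _)) = _
  rw [projX_of_mem hX const_one_mem, koopman_const_one, projX_of_mem hX const_one_mem]

theorem averagingOp_pow_const_one {S : Y → Y} (hS : MeasurePreserving S m m) (hX : mX ≤ mY)
    (k : ℕ) :
    (averagingOp hS hX ^ k) (Lp.const 2 m (1 : ℂ)) = Lp.const 2 m (1 : ℂ) := by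
  induction k with
  | zero => simp
  | succ k ih =>
    rw [pow_succ]
    change (averagingOp hS hX ^ k) (averagingOp hS hX _) = _
    rw [averagingOp_const_one, ih]

theorem mem_L20_iff {f : Lp ℂ 2 m} :
    f ∈ L20 mX m ↔ f ∈ lpMeas ℂ ℂ mX 2 m ∧ inner ℂ (Lp.const 2 m (1 : ℂ)) f = 0 := by
  rw [L20, Submodule.mem_inf, Submodule.mem_orthogonal_singleton_iff_inner_right]

theorem averagingOp_mem_L20 {S : Y → Y} (hS : MeasurePreserving S m m) (hX : mX ≤ mY)
    {f : Lp ℂ 2 m} (hf : f ∈ L20 mX m) : averagingOp hS hX f ∈ L20 mX m := by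
  rw [mem_L20_iff] at hf ⊢
  refine ⟨averagingOp_mem hS hX f, ?_⟩
  change inner ℂ _ (projX hX (koopman hS (projX hX f))) = 0
  rw [inner_projX_right hX _ const_one_mem, projX_of_mem hX hf.1, ← koopman_const_one hS,
    inner_koopman, hf.2]

theorem norm_averagingOp_pow_le {S : Y → Y} (hS : MeasurePreserving S m m) (hX : mX ≤ mY)
    (k : ℕ) {f : Lp ℂ 2 m} (hf : f ∈ L20 mX m) :
    (averagingOp hS hX ^ k) f ∈ L20 mX m ∧
      ‖(averagingOp hS hX ^ k) f‖ ≤ averagingNorm hS hX ^ k * ‖f‖ := by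
  induction k with
  | zero => simpa using hf
  | succ k ih =>
    rw [pow_succ']
    refine ⟨averagingOp_mem_L20 hS hX ih.1, ?_⟩
    have h1 := (averagingOp hS hX ∘L (L20 mX m).subtypeL).le_opNorm
      ⟨(averagingOp hS hX ^ k) f, ih.1⟩
    refine h1.trans ?_
    rw [pow_succ', mul_assoc]
    exact mul_le_mul_of_nonneg_left ih.2 (ContinuousLinearMap.opNorm_nonneg _)

/-- The quadratic form `θ ‖u‖² + (1 - θ) |⟨1, u⟩|²`, which dominates `T ^ k` for `θ = λ ^ k`. -/
noncomputable def mixingForm (θ : ℝ) (u : Lp ℂ 2 m) : ℝ :=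
  θ * ‖u‖ ^ 2 + (1 - θ) * ‖inner ℂ (Lp.const 2 m (1 : ℂ)) u‖ ^ 2

theorem mixingForm_eq (θ : ℝ) (u : Lp ℂ 2 m) :
    mixingForm θ u = ‖inner ℂ (Lp.const 2 m (1 : ℂ)) u‖ ^ 2 +
      θ * ‖u - (inner ℂ (Lp.const 2 m (1 : ℂ)) u : ℂ) • Lp.const 2 m (1 : ℂ)‖ ^ 2 := by
  set e := Lp.const 2 m (1 : ℂ)
  set b : ℂ := inner ℂ e u
  have he : (inner ℂ e e : ℂ) = 1 := by
    rw [inner_self_eq_norm_sq_to_K, norm_const_one]; simp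
  have h0 : (inner ℂ (u - b • e) (b • e) : ℂ) = 0 := by
    rw [inner_sub_left, inner_smul_right, inner_smul_right, inner_smul_left, he,
      ← inner_conj_symm u e]
    simp [b]
  have h1 := norm_add_sq_eq_norm_sq_add_norm_sq_of_inner_eq_zero (u - b • e) (b • e) h0
  rw [sub_add_cancel, norm_smul, norm_const_one, _root_.mul_one] at h1
  rw [mixingForm]
  linear_combination θ * h1

/-- Split `u` and `v` into constant and orthogonal parts. The constant parts contribute a product,
the orthogonal ones at most `θ` times the product of their norms; Cauchy-Schwarz in the plane with
weights `1` and `θ` recombines the two. -/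
theorem norm_inner_averagingOp_pow_le {S : Y → Y} (hS : MeasurePreserving S m m) (hX : mX ≤ mY)
    (k : ℕ) {u v : Lp ℂ 2 m} (hv : v ∈ lpMeas ℂ ℂ mX 2 m) :
    ‖(inner ℂ u ((averagingOp hS hX ^ k) v) : ℂ)‖ ≤
      √(mixingForm (averagingNorm hS hX ^ k) u) * √(mixingForm (averagingNorm hS hX ^ k) v) := by
  set e := Lp.const 2 m (1 : ℂ) with he'
  set θ := averagingNorm hS hX ^ k
  have hθ : 0 ≤ θ := pow_nonneg (ContinuousLinearMap.opNorm_nonneg _) k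
  have he : (inner ℂ e e : ℂ) = 1 := by
    rw [inner_self_eq_norm_sq_to_K, norm_const_one]; simp
  set b : ℂ := inner ℂ e v with hb
  set c : ℂ := inner ℂ e u with hc
  have hv0 : v - b • e ∈ L20 mX m := by
    rw [mem_L20_iff]
    refine ⟨Submodule.sub_mem _ hv (Submodule.smul_mem _ _ const_one_mem), ?_⟩
    rw [inner_sub_right, inner_smul_right, ← he', he]
    simp [b]
  obtain ⟨h1, h2⟩ := norm_averagingOp_pow_le hS hX k hv0
  rw [mem_L20_iff] at h1
  have hdec : (averagingOp hS hX ^ k) v = b • e + (averagingOp hS hX ^ k) (v - b • e) := by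
    rw [map_sub, map_smul, averagingOp_pow_const_one]
    simp [e]
  have h3 : (inner ℂ u ((averagingOp hS hX ^ k) v) : ℂ) =
      b * starRingEnd ℂ c + inner ℂ (u - c • e) ((averagingOp hS hX ^ k) (v - b • e)) := by
    conv_lhs => rw [hdec]
    rw [inner_add_right, inner_smul_right, inner_sub_left (u), inner_smul_left, h1.2, hc,
      inner_conj_symm]
    simp
  rw [h3, mixingForm_eq, mixingForm_eq]
  refine (norm_add_le _ _).trans ?_
  rw [norm_mul, RCLike.norm_conj]
  have h4 : ‖(inner ℂ (u - c • e) ((averagingOp hS hX ^ k) (v - b • e)) : ℂ)‖ ≤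
      ‖u - c • e‖ * (θ * ‖v - b • e‖) :=
    (norm_inner_le_norm _ _).trans (mul_le_mul_of_nonneg_left h2 (norm_nonneg _))
  refine (add_le_add_right h4 _).trans ?_
  rw [← Real.sqrt_mul (by positivity)]
  refine Real.le_sqrt_of_sq_le ?_
  -- By Lagrange's identity this square is exactly the defect in the two-term Cauchy-Schwarz
  -- inequality.
  have h5 := mul_nonneg hθ (sq_nonneg (‖c‖ * ‖v - b • e‖ - ‖b‖ * ‖u - c • e‖))
  nlinarith [h5]

end Prob

end AveragingLemmas

section AveragingLemmas

variable {Y : Type*} {mX mY : MeasurableSpace Y} {m : Measure Y}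

/-! ### The perturbed averaging operator -/

/-- The function `w ↦ w / (ρ - θ w)` is increasing and convex below its pole, so its value at or
below the point `1 - p + p R` is at most its chord over `[1, R]`. -/
theorem div_sub_mul_le_chord {θ ρ R w p : ℝ} (hθ : 0 ≤ θ) (hR : 1 ≤ R) (hp0 : 0 ≤ p) (hp1 : p ≤ 1)
    (hw : w ≤ 1 - p + p * R) (hρ : θ * R < ρ) :
    w / (ρ - θ * w) ≤ (1 - p) * (1 / (ρ - θ)) + p * (R / (ρ - θ * R)) := by
  have hR' : 0 < ρ - θ * R := by linarith
  have h1 : 0 < ρ - θ := by nlinarith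
  have hv : 1 - p + p * R ≤ R := by nlinarith
  have hρ0 : 0 < ρ := by nlinarith
  set v := 1 - p + p * R
  have hv' : 0 < ρ - θ * v := by nlinarith
  have hw' : 0 < ρ - θ * w := by nlinarith
  have step1 : w / (ρ - θ * w) ≤ v / (ρ - θ * v) := by
    rw [div_le_div_iff₀ hw' hv']
    nlinarith
  refine step1.trans ?_
  -- The convexity gap in closed form, visibly nonnegative.
  have key : (1 - p) * (1 / (ρ - θ)) + p * (R / (ρ - θ * R)) - v / (ρ - θ * v) =
      ρ * θ * p * (1 - p) * (R - 1) ^ 2 / ((ρ - θ) * (ρ - θ * R) * (ρ - θ * v)) := by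
    field_simp
    simp only [v]
    ring
  have : 0 ≤ ρ * θ * p * (1 - p) * (R - 1) ^ 2 / ((ρ - θ) * (ρ - θ * R) * (ρ - θ * v)) := by
    have : 0 ≤ 1 - p := by linarith
    positivity
  linarith

theorem exp_mul_le_chord (r : ℝ) {p : ℝ} (hp0 : 0 ≤ p) (hp1 : p ≤ 1) :
    Real.exp (r * p) ≤ 1 - p + p * Real.exp r := by
  have := convexOn_exp.2 (mem_univ 0) (mem_univ r) (sub_nonneg.2 hp1) hp0 (by ring)
  simpa [mul_comm] using this

theorem integral_mul_sq_le {f g : Y → ℝ} (hf : MemLp f 2 m) (hg : MemLp g 2 m) :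
    (∫ y, f y * g y ∂m) ^ 2 ≤ (∫ y, f y ^ 2 ∂m) * ∫ y, g y ^ 2 ∂m := by
  have hfg : Integrable (fun y => f y * g y) m := hf.integrable_mul hg
  have hf2 := hf.integrable_sq
  have hg2 := hg.integrable_sq
  have h : ∀ x : ℝ, 0 ≤ (∫ y, f y ^ 2 ∂m) * (x * x) + (2 * ∫ y, f y * g y ∂m) * x +
      ∫ y, g y ^ 2 ∂m := by
    intro x
    have h0 : 0 ≤ ∫ y, (x * f y + g y) ^ 2 ∂m := integral_nonneg fun y => sq_nonneg _
    have h1 : ∀ y, (x * f y + g y) ^ 2 = x * x * f y ^ 2 + 2 * x * (f y * g y) + g y ^ 2 := by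
      intro y; ring
    simp_rw [h1] at h0
    have i1 : Integrable (fun y => x * x * f y ^ 2) m := hf2.const_mul _
    have i2 : Integrable (fun y => 2 * x * (f y * g y)) m := hfg.const_mul _
    have i3 : Integrable (fun y => x * x * f y ^ 2 + 2 * x * (f y * g y)) m := i1.add i2
    rw [integral_add i3 hg2, integral_add i1 i2, integral_const_mul, integral_const_mul] at h0
    linarith
  have := discrim_le_zero h
  rw [discrim] at this
  nlinarith

variable [IsProbabilityMeasure m]

/-- The generating function `1 - q + q e^r` of the Bernoulli distribution with mean
`q = θ + (1 - θ) β` bounds the form `θ ‖e^{rψ/2} f‖² + (1 - θ) |⟨1, e^{rψ/2} f⟩|²`. -/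
theorem mixingForm_mulOp_le {ψ : Y → ℝ} (hψ : Measurable ψ) (hψ01 : ∀ y, ψ y ∈ Icc (0 : ℝ) 1)
    {θ r : ℝ} (hθ0 : 0 ≤ θ) (hθ1 : θ < 1) (hr : 0 ≤ r) (hβ1 : ∫ y, ψ y ∂m < 1)
    {V : Lp ℂ 2 m →L[ℂ] Lp ℂ 2 m}
    (hV : ∀ f, V f =ᵐ[m] fun y => ((Real.exp (r / 2 * ψ y) : ℝ) : ℂ) * f y) (f : Lp ℂ 2 m) :
    mixingForm θ (V f) ≤
      (1 - (θ + (1 - θ) * ∫ y, ψ y ∂m) + (θ + (1 - θ) * ∫ y, ψ y ∂m) * Real.exp r) * ‖f‖ ^ 2 := by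
  set β := ∫ y, ψ y ∂m with hβ
  have hβ0 : 0 ≤ β := integral_nonneg fun y => (hψ01 y).1
  set R := Real.exp r with hRdef
  have hR : 1 ≤ R := Real.one_le_exp hr
  set ρ := 1 - (θ + (1 - θ) * β) + (θ + (1 - θ) * β) * R with hρdef
  -- Strict because the mean of `ψ` is less than `1`; this keeps the weight `ρ - θ w` positive.
  have hρ : θ * R < ρ := by
    have : ρ - θ * R = (1 - θ) * (1 - β) + (1 - θ) * β * R := by rw [hρdef]; ring
    have h2 : 0 < (1 - θ) * (1 - β) := mul_pos (by linarith) (by linarith)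
    have h3 : 0 ≤ (1 - θ) * β * R := mul_nonneg (mul_nonneg (by linarith) hβ0) (by linarith)
    linarith
  have hρ1 : 0 < ρ - θ := by nlinarith
  have hψi : Integrable ψ m := Integrable.of_bound hψ.aestronglyMeasurable 1
    (Filter.Eventually.of_forall fun y => by
      rw [Real.norm_eq_abs, abs_le]; constructor <;> linarith [(hψ01 y).1, (hψ01 y).2])
  set w : Y → ℝ := fun y => Real.exp (r * ψ y) with hw
  have hwm : Measurable w := (hψ.const_mul r).exp
  have hw0 : ∀ y, 0 < w y := fun y => Real.exp_pos _
  have hwR : ∀ y, w y ≤ R := fun y => Real.exp_le_exp.2 (by nlinarith [(hψ01 y).2])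
  have hwsq : ∀ y, Real.exp (r / 2 * ψ y) ^ 2 = w y := fun y => by
    rw [hw, ← Real.exp_nat_mul]; congr 1; push_cast; ring
  have hden : ∀ y, ρ - θ * R ≤ ρ - θ * w y := fun y => by nlinarith [hwR y]
  have hden0 : ∀ y, 0 < ρ - θ * w y := fun y => lt_of_lt_of_le (by linarith) (hden y)
  have hfm : MemLp (fun y => ‖f y‖) 2 m := (Lp.memLp f).norm
  have hfsq : Integrable (fun y => ‖f y‖ ^ 2) m := hfm.integrable_sq
  have hnorm : ∀ g : Lp ℂ 2 m, ‖g‖ ^ 2 = ∫ y, ‖g y‖ ^ 2 ∂m := by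
    intro g
    have h1 : ((‖g‖ ^ 2 : ℝ) : ℂ) = ((∫ y, ‖g y‖ ^ 2 ∂m : ℝ) : ℂ) := by
      have := inner_self_eq_norm_sq_to_K (𝕜 := ℂ) g
      rw [L2.inner_def] at this
      push_cast
      rw [← integral_complex_ofReal]
      refine Eq.trans this.symm (integral_congr_ae (Filter.Eventually.of_forall fun y => ?_))
      simp only
      rw [inner_self_eq_norm_sq_to_K]
      simp
    exact_mod_cast h1
  have hbdd : ∀ (u : Y → ℝ), Measurable u → (∃ c, ∀ y, |u y| ≤ c) →
      Integrable (fun y => u y * ‖f y‖ ^ 2) m := by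
    rintro u hu ⟨c, hc⟩
    exact hfsq.bdd_mul hu.aestronglyMeasurable (Filter.Eventually.of_forall hc)
  have hwi : Integrable (fun y => w y * ‖f y‖ ^ 2) m :=
    hbdd w hwm ⟨R, fun y => by rw [abs_of_pos (hw0 y)]; exact hwR y⟩
  have hVnorm : ‖V f‖ ^ 2 = ∫ y, w y * ‖f y‖ ^ 2 ∂m := by
    rw [hnorm]
    refine integral_congr_ae ?_
    filter_upwards [hV f] with y hy
    rw [hy, norm_mul, mul_pow, Complex.norm_real, Real.norm_eq_abs, sq_abs, hwsq]
  have hVinner : ‖inner ℂ (Lp.const 2 m (1 : ℂ)) (V f)‖ ≤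
      ∫ y, Real.exp (r / 2 * ψ y) * ‖f y‖ ∂m := by
    rw [L2.inner_def]
    refine (norm_integral_le_integral_norm _).trans (le_of_eq (integral_congr_ae ?_))
    filter_upwards [hV f, Lp.coeFn_const 2 m (1 : ℂ)] with y h1 h2
    rw [h1, h2, Function.const_apply, RCLike.inner_apply, map_one, _root_.mul_one, norm_mul, Complex.norm_real, Real.norm_eq_abs,
      abs_of_pos (Real.exp_pos _)]
  -- Cauchy-Schwarz with the weight `ρ - θ w`
  set a : Y → ℝ := fun y => √(w y / (ρ - θ * w y)) with ha
  set b : Y → ℝ := fun y => √(ρ - θ * w y) * ‖f y‖ with hb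
  have hab : ∀ y, Real.exp (r / 2 * ψ y) * ‖f y‖ = a y * b y := by
    intro y
    rw [ha, hb]
    simp only
    rw [← mul_assoc, ← Real.sqrt_mul (div_nonneg (hw0 y).le (hden0 y).le),
      div_mul_cancel₀ _ (hden0 y).ne', ← hwsq, Real.sqrt_sq (Real.exp_pos _).le]
  have hquot : ∀ y, w y / (ρ - θ * w y) ≤
      (1 - ψ y) * (1 / (ρ - θ)) + ψ y * (R / (ρ - θ * R)) := fun y =>
    div_sub_mul_le_chord hθ0 hR (hψ01 y).1 (hψ01 y).2
      (exp_mul_le_chord r (hψ01 y).1 (hψ01 y).2) hρ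
  have ham : Measurable a := (hwm.div (measurable_const.sub (hwm.const_mul θ))).sqrt
  have hasq : ∀ y, a y ^ 2 = w y / (ρ - θ * w y) := fun y =>
    Real.sq_sqrt (div_nonneg (hw0 y).le (hden0 y).le)
  have hbsq : ∀ y, b y ^ 2 = (ρ - θ * w y) * ‖f y‖ ^ 2 := fun y => by
    rw [hb]; simp only; rw [mul_pow, Real.sq_sqrt (hden0 y).le]
  have hba : Integrable (fun y => (ρ - θ * w y) * ‖f y‖ ^ 2) m := by
    refine hbdd _ (measurable_const.sub (hwm.const_mul θ)) ⟨ρ, fun y => ?_⟩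
    rw [abs_of_pos (hden0 y)]
    nlinarith [hw0 y]
  have hchord : Integrable (fun y => (1 - ψ y) * (1 / (ρ - θ)) + ψ y * (R / (ρ - θ * R))) m :=
    (((integrable_const 1).sub hψi).mul_const _).add (hψi.mul_const _)
  have haint : Integrable (fun y => w y / (ρ - θ * w y)) m := by
    refine hchord.mono (hwm.div (measurable_const.sub (hwm.const_mul θ))).aestronglyMeasurable
      (Filter.Eventually.of_forall fun y => ?_)
    have h0 := div_nonneg (hw0 y).le (hden0 y).le
    rw [Real.norm_eq_abs, Real.norm_eq_abs, abs_of_nonneg h0, abs_of_nonneg (h0.trans (hquot y))]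
    exact hquot y
  have ha2 : MemLp a 2 m := by
    rw [memLp_two_iff_integrable_sq ham.aestronglyMeasurable]
    simpa only [hasq] using haint
  have hb2 : MemLp b 2 m := by
    have hbm : AEStronglyMeasurable b m :=
      ((measurable_const.sub (hwm.const_mul θ)).sqrt.aestronglyMeasurable).mul hfm.1
    rw [memLp_two_iff_integrable_sq hbm]
    simpa only [hbsq] using hba
  have hCS := integral_mul_sq_le ha2 hb2
  simp_rw [hasq, hbsq] at hCS
  -- This inequality dictates `ρ`: after `ρ - θ` is replaced by the smaller `ρ - θ R`, the chord
  -- bound integrates to `(1 - β + β R) / (ρ - θ R)`, and `ρ - θ R = (1 - θ)(1 - β + β R)`.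
  have hI : (1 - θ) * ∫ y, w y / (ρ - θ * w y) ∂m ≤ 1 := by
    have h1 : ∫ y, w y / (ρ - θ * w y) ∂m ≤
        (1 - β) * (1 / (ρ - θ)) + β * (R / (ρ - θ * R)) := by
      refine (integral_mono haint hchord hquot).trans (le_of_eq ?_)
      have i1 : Integrable (fun y => (1 - ψ y) * (1 / (ρ - θ))) m :=
        ((integrable_const 1).sub hψi).mul_const _
      rw [integral_add i1 (hψi.mul_const _), integral_mul_const, integral_mul_const, integral_sub (integrable_const 1) hψi]
      simp [hβ]
    have hD : 0 < ρ - θ * R := by linarith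
    have h2 : (1 - β) * (1 / (ρ - θ)) ≤ (1 - β) * (1 / (ρ - θ * R)) := by
      refine mul_le_mul_of_nonneg_left ?_ (by linarith)
      exact one_div_le_one_div_of_le hD (by nlinarith)
    have h3 : (1 - θ) * ((1 - β) * (1 / (ρ - θ * R)) + β * (R / (ρ - θ * R))) = 1 := by
      have : ρ - θ * R = (1 - θ) * ((1 - β) + β * R) := by rw [hρdef]; ring
      rw [mul_one_div, ← mul_div_assoc, ← add_div, ← mul_div_assoc, ← this, div_self hD.ne']
    refine le_trans ?_ h3.le
    exact mul_le_mul_of_nonneg_left (by linarith) (by linarith)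
  have hB0 : 0 ≤ ∫ y, (ρ - θ * w y) * ‖f y‖ ^ 2 ∂m :=
    integral_nonneg fun y => mul_nonneg (hden0 y).le (sq_nonneg _)
  have hBeq : ∫ y, (ρ - θ * w y) * ‖f y‖ ^ 2 ∂m =
      ρ * ∫ y, ‖f y‖ ^ 2 ∂m - θ * ∫ y, w y * ‖f y‖ ^ 2 ∂m := by
    rw [← integral_const_mul, ← integral_const_mul,
      ← integral_sub (hfsq.const_mul _) (hwi.const_mul _)]
    exact integral_congr_ae (Filter.Eventually.of_forall fun y => by simp only; ring)
  have hsq : ‖inner ℂ (Lp.const 2 m (1 : ℂ)) (V f)‖ ^ 2 ≤ (∫ y, a y * b y ∂m) ^ 2 := by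
    refine pow_le_pow_left₀ (norm_nonneg _) (hVinner.trans (le_of_eq ?_)) 2
    exact integral_congr_ae (Filter.Eventually.of_forall hab)
  have h5 : (1 - θ) * ‖inner ℂ (Lp.const 2 m (1 : ℂ)) (V f)‖ ^ 2 ≤
      ∫ y, (ρ - θ * w y) * ‖f y‖ ^ 2 ∂m := by
    calc _ ≤ (1 - θ) * ((∫ y, w y / (ρ - θ * w y) ∂m) * ∫ y, (ρ - θ * w y) * ‖f y‖ ^ 2 ∂m) :=
          mul_le_mul_of_nonneg_left (hsq.trans hCS) (by linarith)
      _ = ((1 - θ) * ∫ y, w y / (ρ - θ * w y) ∂m) * ∫ y, (ρ - θ * w y) * ‖f y‖ ^ 2 ∂m := by ring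
      _ ≤ 1 * ∫ y, (ρ - θ * w y) * ‖f y‖ ^ 2 ∂m := mul_le_mul_of_nonneg_right hI hB0
      _ = _ := one_mul _
  rw [mixingForm, hVnorm, hnorm f]
  linarith

theorem one_le_bernoulli_mgf {q r : ℝ} (hq : 0 ≤ q) (hr : 0 ≤ r) :
    1 ≤ 1 - q + q * Real.exp r := by
  nlinarith [Real.one_le_exp hr]

/-- Bound for the moment generating function of the sums of `ψ` along `S ^ k`, where `θ = λ ^ k`:
it is at most that of independent Bernoulli variables with mean `θ + (1 - θ) ∫ ψ`. -/
theorem integral_exp_sum_le {S : Y → Y} (hS : MeasurePreserving S m m) (hX : mX ≤ mY)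
    (hM : HasPropertyM hS hX) {ψ : Y → ℝ} (hψ : Measurable[mX] ψ)
    (hψ01 : ∀ y, ψ y ∈ Icc (0 : ℝ) 1) (hβ1 : ∫ y, ψ y ∂m < 1) {k : ℕ} (hk : 1 ≤ k)
    (hlam : averagingNorm hS hX < 1) {r : ℝ} (hr : 0 ≤ r) (N : ℕ) :
    ∫ z, Real.exp (r * ∑ j ∈ Finset.range N, ψ (S^[k * j] z)) ∂m ≤
      (1 - (averagingNorm hS hX ^ k + (1 - averagingNorm hS hX ^ k) * ∫ y, ψ y ∂m) +
        (averagingNorm hS hX ^ k + (1 - averagingNorm hS hX ^ k) * ∫ y, ψ y ∂m) *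
          Real.exp r) ^ N := by
  rcases N with _ | N
  · simp
  have hlam0 : 0 ≤ averagingNorm hS hX := ContinuousLinearMap.opNorm_nonneg _
  set θ := averagingNorm hS hX ^ k with hθ
  have hθ0 : 0 ≤ θ := pow_nonneg hlam0 k
  have hθ1 : θ < 1 := pow_lt_one₀ hlam0 hlam (by omega)
  have hψm : Measurable ψ := hψ.mono hX le_rfl
  set q := θ + (1 - θ) * ∫ y, ψ y ∂m with hq
  have hβ0 : 0 ≤ ∫ y, ψ y ∂m := integral_nonneg fun y => (hψ01 y).1
  have hq0 : 0 ≤ q := add_nonneg hθ0 (mul_nonneg (by linarith) hβ0)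
  set ρ := 1 - q + q * Real.exp r with hρ
  have hρ1 : 1 ≤ ρ := one_le_bernoulli_mgf hq0 hr
  set v : Y → ℝ := fun y => Real.exp (r / 2 * ψ y) with hv
  have hvm : Measurable[mX] v := Real.measurable_exp.comp (hψ.const_mul _)
  have hvb : ∀ y, |v y| ≤ Real.exp (r / 2) := fun y => by
    rw [abs_of_pos (Real.exp_pos _)]
    exact Real.exp_le_exp.2 (by nlinarith [(hψ01 y).1, (hψ01 y).2])
  obtain ⟨V, hV⟩ := exists_mulOp (m := m) v (hvm.mono hX le_rfl) _ hvb
  obtain ⟨M, -, hMU, hMmul, hMX, hMP⟩ := hM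
  have hMV : ∀ f ∈ M, V f ∈ M := fun f hf =>
    hMmul (fun y => (v y : ℂ)) (Complex.measurable_ofReal.comp hvm)
      ⟨_, fun y => by simpa using hvb y⟩ f hf _ (hV f)
  have hMUk : ∀ (j : ℕ), ∀ f ∈ M, (koopman hS ^ j) f ∈ M := by
    intro j f hf
    induction j with
    | zero => simpa using hf
    | succ j ih => rw [pow_succ']; exact hMU _ ih
  set e := Lp.const 2 m (1 : ℂ) with he
  have heX : e ∈ lpMeas ℂ ℂ mX 2 m := const_one_mem
  -- `F N` is the exponential of the sum of `N + 1` terms and lies only in `M`; `g N` stays in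
  -- `L²(X)` and iterates `V T^k V`. They are linked by `P F = V g`. Each factor `e^{rψ}` is split
  -- as `V V` to make the iterated operator symmetric in `V`.
  let g : ℕ → Lp ℂ 2 m := fun N => N.rec (V e) fun _ g => V ((averagingOp hS hX ^ k) (V g))
  let F : ℕ → Lp ℂ 2 m := fun N => N.rec (V (V e)) fun _ f => V (V ((koopman hS ^ k) f))
  have hg_succ : ∀ N, g (N + 1) = V ((averagingOp hS hX ^ k) (V (g N))) := fun N => rfl
  have hF_succ : ∀ N, F (N + 1) = V (V ((koopman hS ^ k) (F N))) := fun N => rfl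
  have hgX : ∀ N, g N ∈ lpMeas ℂ ℂ mX 2 m := by
    intro N
    induction N with
    | zero => exact mulOp_mem_lpMeas hvm hV heX
    | succ N ih =>
      exact mulOp_mem_lpMeas hvm hV (averagingOp_pow_mem hS hX k (mulOp_mem_lpMeas hvm hV ih))
  have hFM : ∀ N, F N ∈ M := by
    intro N
    induction N with
    | zero => exact hMV _ (hMV _ (hMX heX))
    | succ N ih => exact hMV _ (hMV _ (hMUk k _ ih))
  have hPF : ∀ N, projX hX (F N) = V (g N) := by
    intro N
    induction N with
    | zero => exact projX_of_mem hX (mulOp_mem_lpMeas hvm hV (hgX 0))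
    | succ N ih =>
      obtain ⟨k', rfl⟩ : ∃ k', k = k' + 1 := ⟨k - 1, by omega⟩
      rw [hF_succ, hg_succ, projX_mulOp hX hvm hV, projX_mulOp hX hvm hV,
        projX_koopman_pow hS hX hMU hMP k' (hFM N), ih]
  have hform : ∀ f, √(mixingForm θ (V f)) ≤ √ρ * ‖f‖ := by
    intro f
    refine (Real.sqrt_le_sqrt (mixingForm_mulOp_le hψm hψ01 hθ0 hθ1 hr hβ1 hV f)).trans ?_
    rw [Real.sqrt_mul (by linarith), Real.sqrt_sq (norm_nonneg _)]
  -- The square norm is the exponential moment of `ψ` itself, at most `1 - β + β e^r` by convexity,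
  -- and `β ≤ q`.
  have hge : ‖V e‖ ^ 2 ≤ ρ := by
    have h1 : (((‖V e‖ ^ 2 : ℝ)) : ℂ) = ((∫ y, Real.exp (r * ψ y) ∂m : ℝ) : ℂ) := by
      have := inner_self_eq_norm_sq_to_K (𝕜 := ℂ) (V e)
      rw [L2.inner_def] at this
      push_cast
      rw [← integral_complex_ofReal]
      refine Eq.trans this.symm (integral_congr_ae ?_)
      filter_upwards [hV e, Lp.coeFn_const 2 m (1 : ℂ)] with y h1 h2
      rw [h1, h2, Function.const_apply, _root_.mul_one, RCLike.inner_apply, Complex.conj_ofReal,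
        ← Complex.ofReal_mul, ← Real.exp_add]
      congr 2; ring
    have h2 : ‖V e‖ ^ 2 = ∫ y, Real.exp (r * ψ y) ∂m := by exact_mod_cast h1
    have hψi : Integrable ψ m := Integrable.of_bound hψm.aestronglyMeasurable 1
      (Filter.Eventually.of_forall fun y => by
        rw [Real.norm_eq_abs, abs_le]; constructor <;> linarith [(hψ01 y).1, (hψ01 y).2])
    have h3 : ∫ y, Real.exp (r * ψ y) ∂m ≤ ∫ y, (1 - ψ y + ψ y * Real.exp r) ∂m := by
      refine integral_mono_of_nonneg (Filter.Eventually.of_forall fun y => (Real.exp_pos _).le)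
        (((integrable_const 1).sub hψi).add (hψi.mul_const _))
        (Filter.Eventually.of_forall fun y => exp_mul_le_chord r (hψ01 y).1 (hψ01 y).2)
    have i1 : Integrable (fun y => 1 - ψ y) m := (integrable_const 1).sub hψi
    rw [integral_add i1 (hψi.mul_const _), integral_sub (integrable_const 1) hψi,
      integral_mul_const] at h3
    simp only [integral_const, probReal_univ, smul_eq_mul, _root_.mul_one] at h3
    rw [h2]
    refine h3.trans ?_
    have h4 : 0 ≤ θ * (1 - ∫ y, ψ y ∂m) * (Real.exp r - 1) :=
      mul_nonneg (mul_nonneg hθ0 (by linarith)) (by linarith [Real.one_le_exp hr])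
    rw [hρ, hq]
    nlinarith [h4]
  have hgnorm : ∀ N, ‖g N‖ ≤ ρ ^ N * ‖V e‖ := by
    intro N
    induction N with
    | zero => simp [g]
    | succ N ih =>
      -- Pairing `g (N + 1)` with itself and moving one `V` across leaves `T^k` between two vectors
      -- of the form `V f`, where the quadratic form bound applies to each.
      have h1 : ‖g (N + 1)‖ ^ 2 ≤ ρ * ‖g N‖ * ‖g (N + 1)‖ := by
        have h2 : (inner ℂ (g (N + 1)) (g (N + 1)) : ℂ) =
            inner ℂ (V (g (N + 1))) ((averagingOp hS hX ^ k) (V (g N))) := by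
          rw [inner_mulOp hV (g (N + 1)) ((averagingOp hS hX ^ k) (V (g N))), ← hg_succ]
        have h3 := norm_inner_averagingOp_pow_le hS hX k (u := V (g (N + 1)))
          (mulOp_mem_lpMeas hvm hV (hgX N))
        rw [← h2, inner_self_eq_norm_sq_to_K] at h3
        have h4 : ‖((‖g (N + 1)‖ : ℂ)) ^ 2‖ = ‖g (N + 1)‖ ^ 2 := by simp
        refine (h4.symm.le.trans h3).trans ?_
        refine (mul_le_mul (hform _) (hform _) (Real.sqrt_nonneg _) (by positivity)).trans
          (le_of_eq ?_)
        have := Real.mul_self_sqrt (show 0 ≤ ρ by linarith)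
        linear_combination (‖g (N + 1)‖ * ‖g N‖) * this
      have h5 : ‖g (N + 1)‖ ≤ ρ * ‖g N‖ := by
        rcases (norm_nonneg (g (N + 1))).eq_or_lt with h0 | h0
        · rw [← h0]; positivity
        · rw [pow_two] at h1
          exact le_of_mul_le_mul_right h1 h0
      refine h5.trans ((mul_le_mul_of_nonneg_left ih (by linarith)).trans (le_of_eq ?_))
      ring
  have hinner : ‖(inner ℂ e (F N) : ℂ)‖ ≤ ρ ^ (N + 1) := by
    rw [← inner_projX_right hX _ heX, hPF, ← inner_mulOp hV]
    refine (norm_inner_le_norm _ _).trans ?_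
    refine (mul_le_mul_of_nonneg_left (hgnorm N) (norm_nonneg _)).trans ?_
    have : ‖V e‖ * (ρ ^ N * ‖V e‖) = ρ ^ N * ‖V e‖ ^ 2 := by ring
    rw [this, pow_succ]
    exact mul_le_mul_of_nonneg_left hge (by positivity)
  have hFae : ∀ N, F N =ᵐ[m] fun z =>
      ((Real.exp (r * ∑ j ∈ Finset.range (N + 1), ψ (S^[k * j] z)) : ℝ) : ℂ) := by
    intro N
    induction N with
    | zero =>
      filter_upwards [hV (V e), hV e, Lp.coeFn_const 2 m (1 : ℂ)] with y h1 h2 h3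
      change (V (V e)) y = _
      rw [h1, h2, h3, Function.const_apply, _root_.mul_one, ← Complex.ofReal_mul, ← Real.exp_add]
      congr 2
      simp
      ring
    | succ N ih =>
      have h0 := (hS.iterate k).quasiMeasurePreserving.ae_eq_comp ih
      filter_upwards [hV (V ((koopman hS ^ k) (F N))), hV ((koopman hS ^ k) (F N)),
        koopman_pow_apply_ae hS k (F N), h0] with y h1 h2 h3 h4
      rw [hF_succ, h1, h2, h3]
      simp only [Function.comp_apply] at h4
      rw [h4, ← Complex.ofReal_mul, ← Complex.ofReal_mul, ← Real.exp_add, ← Real.exp_add,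
        Finset.sum_range_succ' _ (N + 1)]
      congr 2
      have h5 : ∀ j, S^[k * j] (S^[k] y) = S^[k * (j + 1)] y := fun j => by
        rw [← Function.iterate_add_apply]; rfl
      simp only [h5, mul_zero, Function.iterate_zero, id]
      ring
  have hfin : (inner ℂ e (F N) : ℂ) =
      ((∫ z, Real.exp (r * ∑ j ∈ Finset.range (N + 1), ψ (S^[k * j] z)) ∂m : ℝ) : ℂ) := by
    rw [L2.inner_def, ← integral_complex_ofReal]
    refine integral_congr_ae ?_
    filter_upwards [hFae N, Lp.coeFn_const 2 m (1 : ℂ)] with y h1 h2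
    rw [h1, h2, Function.const_apply, RCLike.inner_apply, map_one, _root_.mul_one]
  rw [hfin, Complex.norm_real, Real.norm_eq_abs] at hinner
  exact (le_abs_self _).trans hinner

end AveragingLemmas

/-! ### The divergence of two-point distributions -/

theorem klTwo_one_sub (η β : ℝ) : klTwo (1 - η) (1 - β) = klTwo η β := by
  simp only [klTwo, sub_sub_cancel]
  ring

/-- One half of the variational formula for `klTwo`. -/
theorem mul_sub_log_le_klTwo {p q : ℝ} (hp0 : 0 < p) (hp1 : p < 1) (hq0 : 0 < q) (hq1 : q < 1)
    (r : ℝ) : r * p - Real.log (1 - q + q * Real.exp r) ≤ klTwo p q := by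
  have hp1' : 0 < 1 - p := by linarith
  have hq1' : 0 < 1 - q := by linarith
  -- Jensen for `log`, with weights `1 - p` and `p`, at the two likelihood ratios of the tilted law
  -- to the law of mean `p`, up to normalization.
  have h := strictConcaveOn_log_Ioi.concaveOn.2
    (show (1 - q) / (1 - p) ∈ Ioi (0 : ℝ) from div_pos hq1' hp1')
    (show q * Real.exp r / p ∈ Ioi (0 : ℝ) by simp only [mem_Ioi]; positivity) hp1'.le hp0.le
    (by ring)
  simp only [smul_eq_mul] at h
  rw [mul_div_cancel₀ _ hp1'.ne', mul_div_cancel₀ _ hp0.ne', mul_div_right_comm,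
    Real.log_mul (div_pos hq0 hp0).ne' (Real.exp_pos r).ne', Real.log_exp] at h
  rw [klTwo]
  linarith

/-- The variational formula for `klTwo` is attained. -/
theorem exists_klTwo_eq {p q : ℝ} (hp1 : p < 1) (hq0 : 0 < q) (hqp : q ≤ p) :
    ∃ r, 0 ≤ r ∧ klTwo p q = r * p - Real.log (1 - q + q * Real.exp r) := by
  have hp0 : 0 < p := hq0.trans_le hqp
  have hp1' : 0 < 1 - p := by linarith
  have hq1' : 0 < 1 - q := by linarith
  have h1 : 0 < p / q := div_pos hp0 hq0
  have h2 : 0 < (1 - q) / (1 - p) := div_pos hq1' hp1'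
  -- The optimal tilt is the log odds ratio, nonnegative because `q ≤ p`.
  refine ⟨Real.log (p / q * ((1 - q) / (1 - p))), Real.log_nonneg ?_, ?_⟩
  · rw [div_mul_div_comm, le_div_iff₀ (mul_pos hq0 hp1')]
    nlinarith
  · rw [Real.exp_log (mul_pos h1 h2)]
    have h3 : 1 - q + q * (p / q * ((1 - q) / (1 - p))) = (1 - q) / (1 - p) := by
      field_simp
      ring
    rw [h3, Real.log_mul h1.ne' h2.ne', klTwo, ← inv_div p q, Real.log_inv]
    ring

theorem klTwo_nonneg {p q : ℝ} (hp0 : 0 < p) (hp1 : p < 1) (hq0 : 0 < q) (hq1 : q < 1) :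
    0 ≤ klTwo p q := by
  simpa using mul_sub_log_le_klTwo hp0 hp1 hq0 hq1 0

/-- With `r ≥ 0` optimal for `(p, q')`, the expression `r p - log (1 - q + q e^r)` increases in `p`
and decreases in `q`, and the variational inequality bounds it for the new pair. -/
theorem klTwo_mono {p p' q q' : ℝ} (hp' : p' < 1) (hq : 0 < q) (hqq' : q ≤ q') (hqp : q' ≤ p)
    (hpp' : p ≤ p') : klTwo p q' ≤ klTwo p' q := by
  obtain ⟨r, hr, h⟩ := exists_klTwo_eq (hpp'.trans_lt hp') (hq.trans_le hqq') hqp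
  have h1 := mul_sub_log_le_klTwo (p := p') (q := q) (by linarith) hp' hq (by linarith) r
  have he : 1 ≤ Real.exp r := Real.one_le_exp hr
  have h2 : Real.log (1 - q + q * Real.exp r) ≤ Real.log (1 - q' + q' * Real.exp r) :=
    Real.log_le_log (by nlinarith) (by nlinarith)
  rw [h]
  nlinarith [mul_le_mul_of_nonneg_left hpp' hr]

/-! ### Large deviations -/

/-- For `r < k`, the number of `i < n` congruent to `r` modulo `k` is `(n - r) / k` rounded up (zero
if `n ≤ r`); the form used here avoids truncated subtraction. -/
theorem sum_range_eq_sum_residues (f : ℕ → ℝ) (n : ℕ) {k : ℕ} (hk : 1 ≤ k) :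
    ∑ i ∈ Finset.range n, f i =
      ∑ r ∈ Finset.range k, ∑ j ∈ Finset.range ((n + k - 1 - r) / k), f (k * j + r) := by
  rw [← Finset.sum_fiberwise_of_maps_to (s := Finset.range n) (t := Finset.range k)
    (g := fun i => i % k) (fun i _ => Finset.mem_range.2 (Nat.mod_lt _ hk))]
  refine Finset.sum_congr rfl fun r hr => ?_
  rw [Finset.mem_range] at hr
  refine Finset.sum_nbij' (fun i => i / k) (fun j => k * j + r) ?_ ?_ ?_ ?_ ?_
  · intro i hi
    simp only [Finset.mem_filter, Finset.mem_range] at hi ⊢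
    rw [Nat.lt_div_iff_mul_lt hk]
    have := Nat.div_add_mod i k
    rw [mul_comm]
    omega
  · intro j hj
    simp only [Finset.mem_filter, Finset.mem_range] at hj ⊢
    rw [Nat.lt_div_iff_mul_lt hk, mul_comm] at hj
    refine ⟨by omega, ?_⟩
    rw [Nat.mul_add_mod, Nat.mod_eq_of_lt hr]
  · intro i hi
    simp only [Finset.mem_filter] at hi
    rw [← hi.2]
    exact Nat.div_add_mod i k
  · intro j _
    rw [Nat.mul_add_div hk, Nat.div_eq_of_lt hr, add_zero]
  · intro i hi
    simp only [Finset.mem_filter] at hi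
    rw [← hi.2, Nat.div_add_mod]

section Deviations

variable {Y : Type*} {mX mY : MeasurableSpace Y} {m : Measure Y} [IsProbabilityMeasure m]

/-- Chernoff bound for the sums along the progression of step `k`. -/
theorem measureReal_sum_ge_le {S : Y → Y} (hS : MeasurePreserving S m m) (hX : mX ≤ mY)
    (hM : HasPropertyM hS hX) {ψ : Y → ℝ} (hψ : Measurable[mX] ψ)
    (hψ01 : ∀ y, ψ y ∈ Icc (0 : ℝ) 1) {k : ℕ} (hk : 1 ≤ k)
    {θ : ℝ} (hθ : θ = averagingNorm hS hX ^ k) (hθ0 : 0 < θ)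
    (hlam : averagingNorm hS hX < 1) {η : ℝ} (hη1 : η < 1)
    (hη : θ + (1 - θ) * ∫ y, ψ y ∂m ≤ η) (i N : ℕ) :
    m.real {z | η * N ≤ ∑ j ∈ Finset.range N, ψ (S^[k * j + i] z)} ≤
      Real.exp (-(N * klTwo η (θ + (1 - θ) * ∫ y, ψ y ∂m))) := by
  have hθ1 : θ < 1 := by
    rw [hθ]; exact pow_lt_one₀ (ContinuousLinearMap.opNorm_nonneg _) hlam (by omega)
  have hψm : Measurable ψ := hψ.mono hX le_rfl
  have hβ0 : 0 ≤ ∫ y, ψ y ∂m := integral_nonneg fun y => (hψ01 y).1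
  have hβ1 : ∫ y, ψ y ∂m < 1 := by
    by_contra hcon
    nlinarith
  set q := θ + (1 - θ) * ∫ y, ψ y ∂m with hq
  have hq0 : 0 < q := add_pos_of_pos_of_nonneg hθ0 (mul_nonneg (by linarith) hβ0)
  -- The exponent optimal for Chernoff's bound.
  obtain ⟨r, hr, hrq⟩ := exists_klTwo_eq hη1 hq0 hη
  have hmgf := integral_exp_sum_le hS hX hM hψ hψ01 hβ1 hk hlam hr N
  rw [← hθ, ← hq] at hmgf
  set f : Y → ℝ := fun z => ∑ j ∈ Finset.range N, ψ (S^[k * j] z) with hf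
  have hfm : Measurable f :=
    Finset.measurable_sum _ fun j _ => hψm.comp (hS.iterate (k * j)).measurable
  have hshift : {z | η * N ≤ ∑ j ∈ Finset.range N, ψ (S^[k * j + i] z)} =
      S^[i] ⁻¹' {z | η * N ≤ f z} := by
    ext z
    simp only [mem_ofPred_eq, mem_preimage, hf, Function.iterate_add_apply]
  rw [hshift, measureReal_def, (hS.iterate i).measure_preimage
    (measurableSet_le measurable_const hfm).nullMeasurableSet, ← measureReal_def]
  have hint : Integrable (fun z => Real.exp (r * f z)) m := by
    refine Integrable.of_bound ((hfm.const_mul r).exp).aestronglyMeasurable (Real.exp (r * N))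
      (Filter.Eventually.of_forall fun z => ?_)
    rw [Real.norm_eq_abs, abs_of_pos (Real.exp_pos _)]
    refine Real.exp_le_exp.2 (mul_le_mul_of_nonneg_left ?_ hr)
    refine (Finset.sum_le_sum fun j _ => (hψ01 (S^[k * j] z)).2).trans ?_
    simp
  have hmarkov := mul_meas_ge_le_integral_of_nonneg
    (Filter.Eventually.of_forall fun z => (Real.exp_pos (r * f z)).le) hint
    (Real.exp (r * (η * N)))
  have hsub : m.real {z | η * N ≤ f z} ≤
      m.real {z | Real.exp (r * (η * N)) ≤ Real.exp (r * f z)} :=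
    measureReal_mono fun z hz => Real.exp_le_exp.2 (mul_le_mul_of_nonneg_left hz hr)
  have hρ : 0 < 1 - q + q * Real.exp r := by
    have := one_le_bernoulli_mgf hq0.le hr
    linarith
  have hexp : Real.exp (-(N * klTwo η q)) =
      (Real.exp (r * (η * N)))⁻¹ * (1 - q + q * Real.exp r) ^ N := by
    rw [hrq, ← Real.exp_neg]
    conv_rhs => rw [← Real.exp_log hρ]
    rw [← Real.exp_nat_mul, ← Real.exp_add]
    congr 1
    ring
  rw [hexp, ← div_eq_inv_mul, le_div_iff₀ (Real.exp_pos _), mul_comm]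
  exact (mul_le_mul_of_nonneg_left hsub (Real.exp_pos _).le).trans (hmarkov.trans hmgf)

/-- The large deviation bound for the sums along the whole orbit. -/
theorem measureReal_orbit_sum_ge_le {S : Y → Y} (hS : MeasurePreserving S m m) (hX : mX ≤ mY)
    (hM : HasPropertyM hS hX) {ψ : Y → ℝ} (hψ : Measurable[mX] ψ)
    (hψ01 : ∀ y, ψ y ∈ Icc (0 : ℝ) 1) {k : ℕ} (hk : 1 ≤ k)
    {θ : ℝ} (hθ : θ = averagingNorm hS hX ^ k) (hθ0 : 0 < θ)
    (hlam : averagingNorm hS hX < 1) {η : ℝ} (hη1 : η < 1)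
    (hη : θ + (1 - θ) * ∫ y, ψ y ∂m ≤ η) (n : ℕ) :
    m.real {z | η * n ≤ ∑ i ∈ Finset.range n, ψ (S^[i] z)} ≤
      k * Real.exp (-((n / k - 1) * klTwo η (θ + (1 - θ) * ∫ y, ψ y ∂m))) := by
  have hβ0 : 0 ≤ ∫ y, ψ y ∂m := integral_nonneg fun y => (hψ01 y).1
  have hθ1 : θ < 1 := by
    rw [hθ]; exact pow_lt_one₀ (ContinuousLinearMap.opNorm_nonneg _) hlam (by omega)
  set q := θ + (1 - θ) * ∫ y, ψ y ∂m with hq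
  have hq0 : 0 < q := add_pos_of_pos_of_nonneg hθ0 (mul_nonneg (by linarith) hβ0)
  have hD : 0 ≤ klTwo η q := klTwo_nonneg (by linarith) hη1 hq0 (by linarith)
  let N : ℕ → ℕ := fun r => (n + k - 1 - r) / k
  -- Pigeonhole: if the average over the whole orbit reaches `η`, so does the average over some
  -- residue class.
  have hsub : {z | η * n ≤ ∑ i ∈ Finset.range n, ψ (S^[i] z)} ⊆
      ⋃ r ∈ Finset.range k, {z | η * N r ≤ ∑ j ∈ Finset.range (N r), ψ (S^[k * j + r] z)} := by
    intro z hz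
    by_contra hcon
    simp only [mem_iUnion, not_exists, mem_ofPred_eq, not_le] at hcon hz
    have h1 := sum_range_eq_sum_residues (fun i => ψ (S^[i] z)) n hk
    have h2 := sum_range_eq_sum_residues (fun _ => η) n hk
    simp only [Finset.sum_const, Finset.card_range, nsmul_eq_mul] at h2
    rw [mul_comm, h1, h2] at hz
    refine absurd hz (not_le.2 (Finset.sum_lt_sum_of_nonempty ⟨0, Finset.mem_range.2 hk⟩ ?_))
    intro r hr
    rw [mul_comm]
    exact hcon r hr
  refine (measureReal_mono hsub (measure_ne_top _ _)).trans ((measureReal_biUnion_finset_le _ _).trans ?_)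
  have hle : ∀ r ∈ Finset.range k,
      m.real {z | η * N r ≤ ∑ j ∈ Finset.range (N r), ψ (S^[k * j + r] z)} ≤
        Real.exp (-((n / k - 1) * klTwo η q)) := by
    intro r hr
    refine (measureReal_sum_ge_le hS hX hM hψ hψ01 hk hθ hθ0 hlam hη1 hη r (N r)).trans ?_
    refine Real.exp_le_exp.2 (neg_le_neg (mul_le_mul_of_nonneg_right ?_ hD))
    have hr' := Finset.mem_range.1 hr
    -- Every class has at least `⌊n / k⌋ > n / k - 1` terms, the source of the loss `-1` in the
    -- exponent.
    have h1 : n / k ≤ N r := Nat.div_le_div_right (by omega)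
    have h2 : n < k * (n / k + 1) := Nat.lt_mul_div_succ n hk
    have hk0 : (0 : ℝ) < k := by exact_mod_cast hk
    have h3 : (n : ℝ) < k * (N r + 1) := by
      have : n < k * (N r + 1) := h2.trans_le (Nat.mul_le_mul_left _ (by omega))
      exact_mod_cast this
    rw [sub_le_iff_le_add, div_le_iff₀ hk0, mul_comm]
    exact h3.le
  refine (Finset.sum_le_sum hle).trans (le_of_eq ?_)
  simp

end Deviations

/-! ### Locally compact second countable groups -/

/-- The right uniformity is complete by local compactness and countably generated by first
countability. -/
theorem polishSpace_of_locallyCompact_group (G : Type*) [Group G] [TopologicalSpace G]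
    [IsTopologicalGroup G] [SecondCountableTopology G] [LocallyCompactSpace G] [T2Space G] :
    PolishSpace G := by
  let _ : UniformSpace G := IsTopologicalGroup.rightUniformSpace G
  have : IsRightUniformGroup G := ⟨rfl⟩
  have : CompleteSpace G := IsRightUniformGroup.completeSpace_of_weaklyLocallyCompactSpace
  have : (uniformity G).IsCountablyGenerated := by
    rw [uniformity_eq_comap_mul_inv_nhds_one]
    infer_instance
  infer_instance

/-! ### The space `Γ \ G` -/

namespace CosetSpace

variable {G : Type*} [Group G] {Γ : Subgroup G}

theorem mk_surjective : Function.Surjective (mk Γ) := Quotient.mk_surjective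

section Topology

variable [TopologicalSpace G]

theorem continuous_mk : Continuous (mk Γ) := continuous_quot_mk

theorem isQuotientMap_mk : IsQuotientMap (mk Γ) := isQuotientMap_quot_mk

variable [IsTopologicalGroup G]

theorem continuous_mul (g : G) : Continuous fun y : CosetSpace Γ => y.mul g :=
  isQuotientMap_mk.continuous_iff.2 (continuous_mk.comp (continuous_mul_const g))

/-- Right translation by `g`, as a homeomorphism. -/
def mulHomeomorph (Γ : Subgroup G) (g : G) : CosetSpace Γ ≃ₜ CosetSpace Γ where
  toFun y := y.mul g
  invFun y := y.mul g⁻¹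
  left_inv y := by simp only [mul_mul, mul_inv_cancel, mul_one]
  right_inv y := by simp only [mul_mul, inv_mul_cancel, mul_one]
  continuous_toFun := continuous_mul g
  continuous_invFun := continuous_mul g⁻¹

instance [SecondCountableTopology G] : SecondCountableTopology (CosetSpace Γ) :=
  ContinuousConstSMul.secondCountableTopology (Γ := Γ) (T := G)

instance [LocallyCompactSpace G] [T2Space G] [DiscreteTopology Γ] : T2Space (CosetSpace Γ) := by
  have : ProperlyDiscontinuousSMul Γ G := by
    let _ : UniformSpace G := IsTopologicalGroup.rightUniformSpace G
    exact Subgroup.properlyDiscontinuousSMul_of_tendsto_cofinite Γ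
      (Γ.tendsto_coe_cofinite_of_discrete ⟨inferInstance⟩)
  exact inferInstanceAs (T2Space (Quotient (MulAction.orbitRel Γ G)))

end Topology

theorem iterate_mul (g : G) (j : ℕ) (y : CosetSpace Γ) :
    (fun y : CosetSpace Γ => y.mul g)^[j] y = y.mul (g ^ j) := by
  induction j with
  | zero => rw [pow_zero, mul_one]; rfl
  | succ j ih => rw [Function.iterate_succ_apply', ih, mul_mul, pow_succ]

theorem mem_mulSet {y z : CosetSpace Γ} {F : Set G} :
    z ∈ y.mulSet F ↔ ∃ f ∈ F, y.mul f⁻¹ = z := Iff.rfl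

section Measure

variable [TopologicalSpace G] [IsTopologicalGroup G]

theorem measurePreserving_mul_inv {μ : Measure (CosetSpace Γ)} {g : G}
    (h : MeasurePreserving (fun y : CosetSpace Γ => y.mul g) μ μ) :
    MeasurePreserving (fun y : CosetSpace Γ => y.mul g⁻¹) μ μ :=
  MeasurePreserving.symm (mulHomeomorph Γ g).toMeasurableEquiv h

variable [SecondCountableTopology G] [MeasurableSpace G] [BorelSpace G]
  [LocallyCompactSpace G] [T2Space G] [DiscreteTopology Γ]

/-- The measure of the translated set `y F` is a Borel function of `y`. -/
theorem measurable_measure_mulSet (μ : Measure (CosetSpace Γ)) [IsProbabilityMeasure μ]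
    {F : Set G} (hF : MeasurableSet F) : Measurable fun y : CosetSpace Γ => μ (y.mulSet F) := by
  have : PolishSpace G := polishSpace_of_locallyCompact_group G
  have : Countable Γ := countable_of_Lindelof_of_discrete
  let R : Set (CosetSpace Γ × CosetSpace Γ) := {p | p.2 ∈ p.1.mulSet F}
  -- Upstairs the relation is a countable union of continuous preimages of `F`. Since `G × G` is
  -- Polish, a set in the quotient is Borel as soon as its preimage is.
  have hR : MeasurableSet R := by
    have hf : Measurable (Prod.map (mk Γ) (mk Γ)) :=
      continuous_mk.measurable.prodMap continuous_mk.measurable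
    have hs : Function.Surjective (Prod.map (mk Γ) (mk Γ)) := mk_surjective.prodMap mk_surjective
    rw [← hf.measurableSet_preimage_iff_of_surjective hs]
    have h1 : Prod.map (mk Γ) (mk Γ) ⁻¹' R =
        ⋃ γ : Γ, (fun p : G × G => p.2⁻¹ * γ * p.1) ⁻¹' F := by
      ext ⟨x, w⟩
      simp only [mem_preimage, mem_iUnion, Prod.map_apply]
      change mk Γ w ∈ (mk Γ x).mulSet F ↔ _
      rw [mem_mulSet]
      constructor
      · rintro ⟨f, hf, h⟩
        rw [mk_mul, mk_eq_mk_iff] at h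
        obtain ⟨γ, hγ, h⟩ := h
        refine ⟨⟨γ⁻¹, Γ.inv_mem hγ⟩, ?_⟩
        have : w⁻¹ * γ⁻¹ * x = f := by
          rw [← mul_inv_rev, h]; group
        simpa only [this] using hf
      · rintro ⟨⟨γ, hγ⟩, h⟩
        refine ⟨_, h, ?_⟩
        rw [mk_mul, mk_eq_mk_iff]
        exact ⟨γ⁻¹, Γ.inv_mem hγ, by group⟩
    rw [h1]
    refine MeasurableSet.iUnion fun γ => ?_
    have hc : Continuous fun p : G × G => p.2⁻¹ * γ * p.1 := by fun_prop
    exact hc.measurable hF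
  exact measurable_measure_prodMk_left hR

end Measure

end CosetSpace

/-! ### Unimodularity and counting -/

section Weil

variable {G : Type*} [Group G] [TopologicalSpace G] [IsTopologicalGroup G]
  [MeasurableSpace G] [BorelSpace G] {Γ : Subgroup G}
  {m : Measure (CosetSpace Γ)} {mG : Measure G}

/-- Right translation carries fibres bijectively to fibres and preserves `m`, so the counting
integral is unchanged. Thus `G` is unimodular. -/
theorem InducesQuotientMeasure.isMulRightInvariant (hmG : InducesQuotientMeasure mG m)
    (hm : ∀ g : G, MeasurePreserving (fun y : CosetSpace Γ => y.mul g) m m) :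
    mG.IsMulRightInvariant := by
  refine ⟨fun g => Measure.ext fun E hE => ?_⟩
  have hg : Measurable fun x : G => x * g := (continuous_mul_const g).measurable
  rw [Measure.map_apply hg hE, hmG _ (hg hE), hmG _ hE]
  refine Eq.trans ?_
    ((hm g).lintegral_comp_emb (CosetSpace.mulHomeomorph Γ g).measurableEmbedding _)
  symm
  refine lintegral_congr fun y => ?_
  have h1 : E ∩ CosetSpace.mk Γ ⁻¹' {y.mul g} =
      (fun x : G => x * g) '' ((fun x => x * g) ⁻¹' E ∩ CosetSpace.mk Γ ⁻¹' {y}) := by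
    ext x
    constructor
    · rintro ⟨hx, hxy⟩
      refine ⟨x * g⁻¹, ⟨by simpa using hx, ?_⟩, by simp⟩
      rw [mem_preimage, mem_singleton_iff] at hxy ⊢
      rw [← CosetSpace.mk_mul, hxy, CosetSpace.mul_mul, mul_inv_cancel, CosetSpace.mul_one]
    · rintro ⟨x, ⟨hx, hxy⟩, rfl⟩
      refine ⟨hx, ?_⟩
      rw [mem_preimage, mem_singleton_iff] at hxy ⊢
      rw [← hxy]
      rfl
  rw [h1, (mul_left_injective g).encard_image]

variable [SecondCountableTopology G] [LocallyCompactSpace G]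

/-- The inverse measure is again left Haar, hence `c • mG`; inverting twice gives `c² = 1`. This is
needed because the sets `y F` are formed with inverses. -/
theorem isInvInvariant_of_isMulRightInvariant [T2Space G] (mG : Measure G) [mG.IsHaarMeasure]
    [mG.IsMulRightInvariant] : mG.IsInvInvariant := by
  constructor
  let c : ℝ≥0∞ := Measure.haarScalarFactor mG.inv mG
  have hc : mG.inv = c • mG := Measure.isMulLeftInvariant_eq_smul_of_regular mG.inv mG
  have h1 : Measure.map Inv.inv (Measure.map Inv.inv mG) = c ^ 2 • mG := by
    rw [← Measure.inv_def mG, hc, Measure.map_smul, ← Measure.inv_def mG, hc, smul_smul, pow_two]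
  have h2 : mG = c ^ 2 • mG := by
    rw [Measure.map_map measurable_inv measurable_inv] at h1
    simpa only [inv_involutive, Function.Involutive.comp_self, Measure.map_id] using h1
  have K : TopologicalSpace.PositiveCompacts G := Classical.arbitrary _
  have h3 : c ^ 2 * mG K = 1 ^ 2 * mG K := by
    conv_rhs => rw [h2]
    simp
  have h4 : c ^ 2 = 1 ^ 2 :=
    (ENNReal.mul_left_inj (Measure.measure_pos_of_nonempty_interior _ K.interior_nonempty).ne'
      K.isCompact.measure_lt_top.ne).1 h3
  have h5 : c = 1 := (ENNReal.pow_right_strictMono two_ne_zero).injective h4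
  rw [hc, h5, one_smul]

/-- If the translates `y S`, for `y` in a finite set, are embedded, pairwise disjoint and contained
in the Borel set `Z`, then their number times the measure of `S` is at most the measure of `Z`. -/
theorem InducesQuotientMeasure.card_mul_le [T2Space G] [mG.IsHaarMeasure]
    (hmG : InducesQuotientMeasure mG m)
    (hm : ∀ g : G, MeasurePreserving (fun y : CosetSpace Γ => y.mul g) m m)
    {S : Set G} (hS : MeasurableSet S) (T : Finset (CosetSpace Γ)) {Z : Set (CosetSpace Γ)}
    (hZ : MeasurableSet Z)
    (hinj : ∀ x : G, CosetSpace.mk Γ x ∈ T → InjOn (CosetSpace.mk Γ) ((fun b => x * b⁻¹) '' S))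
    (hdisj : (T : Set (CosetSpace Γ)).PairwiseDisjoint fun y => y.mulSet S)
    (hTZ : ∀ y ∈ T, y.mulSet S ⊆ Z) :
    T.card * mG S ≤ m Z := by
  have := hmG.isMulRightInvariant hm
  have := isInvInvariant_of_isMulRightInvariant mG
  let x : CosetSpace Γ → G := fun y => (CosetSpace.mk_surjective y).choose
  have hx : ∀ y, CosetSpace.mk Γ (x y) = y := fun y => (CosetSpace.mk_surjective y).choose_spec
  let P : CosetSpace Γ → Set G := fun y => (fun b => x y * b⁻¹) '' S
  have hPpre : ∀ y, P y = (fun z => z⁻¹ * x y) ⁻¹' S := by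
    intro y
    ext z
    constructor
    · rintro ⟨b, hb, rfl⟩
      simpa using hb
    · intro hz
      exact ⟨_, hz, by group⟩
  have hPm : ∀ y, MeasurableSet (P y) := by
    intro y
    rw [hPpre]
    have hc : Continuous fun z : G => z⁻¹ * x y := by fun_prop
    exact hc.measurable hS
  have hPmeas : ∀ y, mG (P y) = mG S := by
    intro y
    have h1 : P y = Inv.inv ⁻¹' ((fun z => z * x y) ⁻¹' S) := hPpre y
    rw [h1, Measure.measure_preimage_inv, measure_preimage_mul_right]
  have hPmk : ∀ y, ∀ z ∈ P y, CosetSpace.mk Γ z ∈ y.mulSet S := by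
    rintro y _ ⟨b, hb, rfl⟩
    refine ⟨b, hb, ?_⟩
    conv_lhs => rw [← hx y]
    rfl
  have hPd : (T : Set (CosetSpace Γ)).PairwiseDisjoint P := by
    intro y hy y' hy' hne
    refine Set.disjoint_left.2 fun z hz hz' => ?_
    exact Set.disjoint_left.1 (hdisj hy hy' hne) (hPmk y z hz) (hPmk y' z hz')
  have hE : mG (⋃ y ∈ T, P y) = T.card * mG S := by
    rw [measure_biUnion_finset hPd fun y _ => hPm y]
    simp [hPmeas]
  rw [← hE, hmG _ (T.measurableSet_biUnion fun y _ => hPm y), ← lintegral_indicator_one hZ]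
  refine lintegral_mono fun z => ?_
  by_cases hz : z ∈ Z
  · rw [indicator_of_mem hz, Pi.one_apply]
    -- Disjointness downstairs forces two preimages of `z` into the same lift, and injectivity there
    -- identifies them.
    have : ((⋃ y ∈ T, P y) ∩ CosetSpace.mk Γ ⁻¹' {z}).encard ≤ 1 := by
      rw [encard_le_one_iff]
      rintro u v ⟨hu, huz⟩ ⟨hv, hvz⟩
      simp only [mem_iUnion] at hu hv
      obtain ⟨y, hy, hu⟩ := hu
      obtain ⟨y', hy', hv⟩ := hv
      rw [mem_preimage, mem_singleton_iff] at huz hvz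
      have hyy : y = y' := by
        by_contra hne
        refine Set.disjoint_left.1 (hdisj hy hy' hne) (hPmk y u hu) ?_
        rw [huz, ← hvz]
        exact hPmk y' v hv
      subst hyy
      exact hinj (x y) (by rwa [hx]) hu hv (huz.trans hvz.symm)
    calc _ ≤ ((1 : ℕ∞) : ℝ≥0∞) := ENat.toENNReal_mono this
      _ = 1 := by simp
  · rw [indicator_of_notMem hz]
    have : (⋃ y ∈ T, P y) ∩ CosetSpace.mk Γ ⁻¹' {z} = ∅ := by
      rw [eq_empty_iff_forall_notMem]
      rintro u ⟨hu, huz⟩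
      simp only [mem_iUnion] at hu
      obtain ⟨y, hy, hu⟩ := hu
      rw [mem_preimage, mem_singleton_iff] at huz
      exact hz (hTZ y hy (huz ▸ hPmk y u hu))
    simp [this]

/-- A maximal finite family of points of `A` whose translates of `S` are disjoint. -/
theorem InducesQuotientMeasure.exists_maximal_disjoint [T2Space G] [mG.IsHaarMeasure]
    [IsProbabilityMeasure m] (hmG : InducesQuotientMeasure mG m)
    (hm : ∀ g : G, MeasurePreserving (fun y : CosetSpace Γ => y.mul g) m m)
    {S : Set G} (hS : MeasurableSet S) (hS0 : 0 < mG S) {A : Set (CosetSpace Γ)}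
    (hinj : ∀ x : G, CosetSpace.mk Γ x ∈ A → InjOn (CosetSpace.mk Γ) ((fun b => x * b⁻¹) '' S)) :
    ∃ T : Finset (CosetSpace Γ), (T : Set (CosetSpace Γ)) ⊆ A ∧
      (T : Set (CosetSpace Γ)).PairwiseDisjoint (fun y => y.mulSet S) ∧
      ∀ y ∈ A, ∃ y' ∈ T, ¬ Disjoint (y.mulSet S) (y'.mulSet S) := by
  classical
  let s : Set ℕ := {n | ∃ T : Finset (CosetSpace Γ), (T : Set (CosetSpace Γ)) ⊆ A ∧
    (T : Set (CosetSpace Γ)).PairwiseDisjoint (fun y => y.mulSet S) ∧ T.card = n}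
  have hs0 : s.Nonempty := ⟨0, ∅, by simp, by simp, rfl⟩
  -- Disjoint translates pack into total mass `1`, so their number is bounded and a family of
  -- largest cardinality exists.
  obtain ⟨b, hb⟩ := ENNReal.exists_nat_mul_gt hS0.ne' (ENNReal.one_ne_top)
  have hsb : BddAbove s := by
    refine ⟨b, ?_⟩
    rintro n ⟨T, hTA, hTd, rfl⟩
    have h1 := hmG.card_mul_le hm hS T MeasurableSet.univ (fun x hx => hinj x (hTA hx)) hTd
      fun _ _ => subset_univ _
    rw [measure_univ] at h1
    by_contra hcon
    refine absurd (hb.trans_le ((mul_le_mul_left ?_ _).trans h1)) (lt_irrefl _)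
    exact_mod_cast (not_le.1 hcon).le
  obtain ⟨T, hTA, hTd, hTc⟩ := Nat.sSup_mem hs0 hsb
  refine ⟨T, hTA, hTd, fun y hy => ?_⟩
  by_contra! hcon
  have hSne : S.Nonempty := nonempty_of_measure_ne_zero hS0.ne'
  have hyT : y ∉ T := by
    intro hyT
    have h1 := hcon y hyT
    rw [disjoint_self, bot_eq_empty] at h1
    exact (hSne.image _).ne_empty h1
  have h2 : (insert y T).card ∈ s := by
    refine ⟨insert y T, ?_, ?_, rfl⟩
    · rw [Finset.coe_insert]
      exact insert_subset hy hTA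
    · rw [Finset.coe_insert]
      exact hTd.insert fun y' hy' _ => hcon y' hy'
  have h3 := le_csSup hsb h2
  rw [Finset.card_insert_of_notMem hyT, hTc] at h3
  omega

end Weil

/-! ### Bowen balls -/

section Bowen

variable {G : Type*} [Group G]

theorem mem_bowenBall {a : G} {B : Set G} {s t : ℤ} {x : G} :
    x ∈ bowenBall a B s t ↔ ∀ i ∈ Icc s t, a ^ i * x * a ^ (-i) ∈ B := by
  simp only [bowenBall, mem_iInter]
  refine forall₂_congr fun i _ => ?_
  constructor
  · rintro ⟨b, hb, rfl⟩
    have : a ^ i * (a ^ (-i) * b * a ^ i) * a ^ (-i) = b := by group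
    rwa [this]
  · intro h
    exact ⟨_, h, by group⟩

theorem bowenBall_eq_iInter (a : G) (B : Set G) (s t : ℤ) :
    bowenBall a B s t = ⋂ i ∈ Icc s t, (fun x => a ^ i * x * a ^ (-i)) ⁻¹' B := by
  ext x
  simp only [mem_bowenBall, mem_iInter, mem_preimage]

/-- A common point `y b⁻¹ = y' b'⁻¹` gives `y = y' (b⁻¹ b')⁻¹`, and conjugation by powers of `a`
respects `b⁻¹ b'`. A maximal packing by `B₀`-balls is therefore a covering by `B`-balls. -/
theorem mem_mulSet_bowenBall_of_not_disjoint {Γ : Subgroup G} {a : G} {B B₀ : Set G}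
    (hB : ∀ x ∈ B₀, ∀ y ∈ B₀, x⁻¹ * y ∈ B) {s t : ℤ} {y y' : CosetSpace Γ}
    (h : ¬ Disjoint (y.mulSet (bowenBall a B₀ s t)) (y'.mulSet (bowenBall a B₀ s t))) :
    y ∈ y'.mulSet (bowenBall a B s t) := by
  obtain ⟨z, ⟨b, hb, hz⟩, b', hb', hz'⟩ := Set.not_disjoint_iff.1 h
  refine ⟨b⁻¹ * b', ?_, ?_⟩
  · rw [mem_bowenBall] at hb hb' ⊢
    intro i hi
    have : a ^ i * (b⁻¹ * b') * a ^ (-i) =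
        (a ^ i * b * a ^ (-i))⁻¹ * (a ^ i * b' * a ^ (-i)) := by group
    rw [this]
    exact hB _ (hb i hi) _ (hb' i hi)
  · have h1 : (y'.mul b'⁻¹).mul b = (y.mul b⁻¹).mul b := congrArg (fun w => w.mul b)
      (hz'.trans hz.symm)
    rw [CosetSpace.mul_mul, CosetSpace.mul_mul, inv_mul_cancel, CosetSpace.mul_one] at h1
    simpa using h1

theorem exists_mul_eq_of_mem_mulSet_bowenBall {Γ : Subgroup G} {a : G} {B : Set G} {s t : ℤ}
    {y z : CosetSpace Γ} (hz : z ∈ y.mulSet (bowenBall a B s t)) {i : ℤ} (hi : i ∈ Icc s t) :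
    ∃ c ∈ B, (z.mul (a ^ (-i))).mul c = y.mul (a ^ (-i)) := by
  obtain ⟨b, hb, rfl⟩ := hz
  refine ⟨_, mem_bowenBall.1 hb i hi, ?_⟩
  rw [CosetSpace.mul_mul, CosetSpace.mul_mul]
  congr 1
  group

variable [TopologicalSpace G] [IsTopologicalGroup G] [MeasurableSpace G] [BorelSpace G]

theorem measurableSet_bowenBall (a : G) {B : Set G} (hB : MeasurableSet B) (s t : ℤ) :
    MeasurableSet (bowenBall a B s t) := by
  rw [bowenBall_eq_iInter]
  refine MeasurableSet.biInter (to_countable _) fun i _ => ?_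
  have hc : Continuous fun x : G => a ^ i * x * a ^ (-i) := by fun_prop
  exact hc.measurable hB

/-- Conjugates of a null set are null by bi-invariance. This permits replacing `B₀` by its part
inside the support of Haar measure. -/
theorem measure_bowenBall_le_of_null_diff (mG : Measure G) [mG.IsMulLeftInvariant]
    [mG.IsMulRightInvariant] (a : G) {B B' : Set G} (h : mG (B \ B') = 0) (s t : ℤ) :
    mG (bowenBall a B s t) ≤ mG (bowenBall a B' s t) := by
  have hsub : bowenBall a B s t ⊆
      bowenBall a B' s t ∪ ⋃ i ∈ Icc s t, (fun x => a ^ i * x * a ^ (-i)) ⁻¹' (B \ B') := by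
    intro x hx
    by_cases hx' : x ∈ bowenBall a B' s t
    · exact Or.inl hx'
    · rw [mem_bowenBall] at hx hx'
      push Not at hx'
      obtain ⟨i, hi, h⟩ := hx'
      exact Or.inr (mem_biUnion hi ⟨hx i hi, h⟩)
  have hnull : mG (⋃ i ∈ Icc s t, (fun x => a ^ i * x * a ^ (-i)) ⁻¹' (B \ B')) = 0 := by
    rw [measure_biUnion_null_iff (to_countable _)]
    intro i _
    have h1 : (fun x => a ^ i * x * a ^ (-i)) ⁻¹' (B \ B') =
        (fun x => a ^ i * x) ⁻¹' ((fun x => x * a ^ (-i)) ⁻¹' (B \ B')) := rfl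
    rw [h1, measure_preimage_mul, measure_preimage_mul_right, h]
  calc _ ≤ _ := measure_mono hsub
    _ ≤ _ := measure_union_le _ _
    _ = _ := by rw [hnull, add_zero]

end Bowen

/-! ### Essential suprema -/

section Envelope

variable {G : Type*} [Group G] {Γ : Subgroup G}

section

variable [MeasurableSpace G] {mG : Measure G} {B : Set G} {φ : CosetSpace Γ → ℝ}

theorem isBoundedUnder_le_of_mem_Icc {α : Type*} {l : Filter α} {f : α → ℝ}
    (hf : ∀ x, f x ∈ Icc (0 : ℝ) 1) : l.IsBoundedUnder (· ≤ ·) f :=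
  Filter.isBoundedUnder_of ⟨1, fun x => (hf x).2⟩

theorem isCoboundedUnder_le_of_mem_Icc {α : Type*} {l : Filter α} [l.NeBot] {f : α → ℝ}
    (hf : ∀ x, f x ∈ Icc (0 : ℝ) 1) : l.IsCoboundedUnder (· ≤ ·) f :=
  Filter.IsBoundedUnder.isCoboundedUnder_le (Filter.isBoundedUnder_of ⟨0, fun x => (hf x).1⟩)

/-- Reflection exchanges the two envelopes. -/
theorem lowerEnvelope_eq_one_sub (hB : mG.restrict B ≠ 0) (hφ : ∀ y, φ y ∈ Icc (0 : ℝ) 1)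
    (y : CosetSpace Γ) :
    lowerEnvelope mG B φ y = 1 - upperEnvelope mG B (fun y => 1 - φ y) y := by
  have : (ae (mG.restrict B)).NeBot := ae_neBot.2 hB
  have hφ' : ∀ y, 1 - φ y ∈ Icc (0 : ℝ) 1 := fun y =>
    ⟨by linarith [(hφ y).2], by linarith [(hφ y).1]⟩
  have h := Antitone.map_limsup_of_continuousAt (F := ae (mG.restrict B))
    (f := fun x : ℝ => 1 - x) (fun x x' hx => by simp only; linarith)
    (fun b : G => 1 - φ (y.mul b)) (by fun_prop)
    (isBoundedUnder_le_of_mem_Icc fun b => hφ' (y.mul b))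
    (isCoboundedUnder_le_of_mem_Icc fun b => hφ' (y.mul b))
  simp only [Function.comp_def, sub_sub_cancel] at h
  exact h.symm

theorem upperEnvelope_mem_Icc (hB : mG.restrict B ≠ 0) (hφ : ∀ y, φ y ∈ Icc (0 : ℝ) 1)
    (y : CosetSpace Γ) : upperEnvelope mG B φ y ∈ Icc (0 : ℝ) 1 := by
  have : (ae (mG.restrict B)).NeBot := ae_neBot.2 hB
  constructor
  · obtain ⟨b, hb⟩ := (ae_le_essSup (μ := mG.restrict B) (f := fun b : G => φ (y.mul b))
      (isBoundedUnder_le_of_mem_Icc fun b => hφ (y.mul b))).exists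
    exact (hφ _).1.trans hb
  · exact essSup_le_of_ae_le 1 (Filter.Eventually.of_forall fun b => (hφ (y.mul b)).2)
      (isCoboundedUnder_le_of_mem_Icc fun b => hφ (y.mul b))

/-- Elements of `B` normalize `K`, so `y k b = (y b)(b⁻¹ k b)` differs from `y b` by an element of
`K`. -/
theorem upperEnvelope_mul_of_mem {K : Subgroup G} (hBm : MeasurableSet B)
    (hBN : B ⊆ (Subgroup.normalizer (K : Set G) : Set G))
    (hK : ∀ y, ∀ k ∈ K, φ (y.mul k) = φ y) (y : CosetSpace Γ) {k : G} (hk : k ∈ K) :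
    upperEnvelope mG B φ (y.mul k) = upperEnvelope mG B φ y := by
  refine essSup_congr_ae ?_
  filter_upwards [ae_restrict_mem hBm] with b hb
  have hconj : b⁻¹ * k * b ∈ K := by
    have h1 := Subgroup.mem_normalizer_iff.1 (inv_mem (hBN hb)) k
    simpa using h1.1 hk
  have h2 : (y.mul k).mul b = (y.mul b).mul (b⁻¹ * k * b) := by
    rw [CosetSpace.mul_mul, CosetSpace.mul_mul]
    congr 1
    group
  rw [h2, hK _ _ hconj]

end

variable [TopologicalSpace G]

theorem eq_of_measurable_stateAlgebra {K : Subgroup G} {φ : CosetSpace Γ → ℝ}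
    (hφ : Measurable[stateAlgebra Γ K] φ) (y : CosetSpace Γ) {k : G} (hk : k ∈ K) :
    φ (y.mul k) = φ y := by
  obtain ⟨A, -, hA⟩ := hφ (measurableSet_singleton (φ y))
  have h1 : StateSpace.mk Γ K y = StateSpace.mk Γ K (y.mul k) := Quotient.sound ⟨k, hk, rfl⟩
  have h2 : y ∈ StateSpace.mk Γ K ⁻¹' A := by rw [hA]; rfl
  have h3 : y.mul k ∈ StateSpace.mk Γ K ⁻¹' A := by
    rw [mem_preimage, ← h1]; exact h2
  rw [hA] at h3
  exact h3

/-- Superlevel sets are open and `K`-saturated, so they are preimages of open sets of `X`. -/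
theorem LowerSemicontinuous.measurable_stateAlgebra {K : Subgroup G} {φ : CosetSpace Γ → ℝ}
    (hφ : LowerSemicontinuous φ) (hK : ∀ y, ∀ k ∈ K, φ (y.mul k) = φ y) :
    Measurable[stateAlgebra Γ K] φ := by
  refine @measurable_of_Ioi _ _ _ _ _ (stateAlgebra Γ K) _ _ _ _ fun c => ?_
  have hpre : StateSpace.mk Γ K ⁻¹' (StateSpace.mk Γ K '' (φ ⁻¹' Ioi c)) = φ ⁻¹' Ioi c := by
    refine Subset.antisymm ?_ (subset_preimage_image _ _)
    rintro y ⟨y', hy', h⟩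
    obtain ⟨k, hk, rfl⟩ := Quotient.exact h
    rw [mem_preimage, hK y' k hk]
    exact hy'
  refine ⟨StateSpace.mk Γ K '' (φ ⁻¹' Ioi c), ?_, hpre⟩
  refine MeasurableSpace.measurableSet_generateFrom ?_
  have hq : IsQuotientMap (StateSpace.mk Γ K) := isQuotientMap_quot_mk
  refine hq.isOpen_preimage.1 ?_
  rw [hpre]
  exact hφ.isOpen_preimage c

variable [IsTopologicalGroup G]

theorem isOpen_setOf_lt_mul {φ : CosetSpace Γ → ℝ} (hφ : LowerSemicontinuous φ) (y : CosetSpace Γ) (c : ℝ) :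
    IsOpen {b : G | c < φ (y.mul b)} := by
  obtain ⟨x, rfl⟩ := CosetSpace.mk_surjective y
  exact (hφ.isOpen_preimage c).preimage
    (CosetSpace.continuous_mk.comp (continuous_const_mul x))

variable [MeasurableSpace G] {mG : Measure G} {B : Set G}
  {φ : CosetSpace Γ → ℝ}

/-- Translates by the points in the support of `B` are controlled by the essential supremum. -/
theorem apply_mul_le_upperEnvelope (hφl : LowerSemicontinuous φ)
    (hφ : ∀ y, φ y ∈ Icc (0 : ℝ) 1) (y : CosetSpace Γ) {b : G}
    (hb : b ∈ (mG.restrict B).support) : φ (y.mul b) ≤ upperEnvelope mG B φ y := by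
  by_contra! hcon
  -- If the bound failed at `b`, it would fail on a whole neighbourhood of `b`, which has positive
  -- measure because `b` is in the support.
  have hopen := isOpen_setOf_lt_mul hφl y (upperEnvelope mG B φ y)
  have hpos := (Measure.mem_support_iff_forall b).1 hb _ (hopen.mem_nhds hcon)
  have hae := ae_le_essSup (μ := mG.restrict B) (f := fun b : G => φ (y.mul b))
    (isBoundedUnder_le_of_mem_Icc fun b => hφ (y.mul b))
  rw [ae_iff] at hae
  refine hpos.ne' ?_
  convert hae using 3
  simp only [not_le]
  rfl

/-- For lower-semicontinuous `φ` the essential supremum is a true supremum over the support, hence a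
supremum of lower-semicontinuous functions. -/
theorem lowerSemicontinuous_upperEnvelope [SecondCountableTopology G] [BorelSpace G]
    (hB : mG.restrict B ≠ 0)
    (hφl : LowerSemicontinuous φ) (hφ : ∀ y, φ y ∈ Icc (0 : ℝ) 1) :
    LowerSemicontinuous (upperEnvelope mG B φ) := by
  have : (ae (mG.restrict B)).NeBot := ae_neBot.2 hB
  intro y c hc
  have hsupp : (mG.restrict B).support ∈ ae (mG.restrict B) := by
    rw [mem_ae_iff]; exact Measure.measure_compl_support
  have hex : ∃ b ∈ (mG.restrict B).support, c < φ (y.mul b) := by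
    by_contra! hcon
    refine absurd hc (not_lt.2 (essSup_le_of_ae_le c ?_
      (isCoboundedUnder_le_of_mem_Icc fun b => hφ (y.mul b))))
    filter_upwards [hsupp] with b hb
    exact hcon b hb
  obtain ⟨b, hb, hcb⟩ := hex
  have hcont := (CosetSpace.continuous_mul (Γ := Γ) b).tendsto y
  filter_upwards [hcont.eventually (hφl (y.mul b) c hcb)] with y' hy'
  exact lt_of_lt_of_le hy' (apply_mul_le_upperEnvelope hφl hφ y' hb)

end Envelope

/-! ### The covering argument -/

section Covering

variable {G : Type*} [Group G] [TopologicalSpace G] [MeasurableSpace G] [BorelSpace G] {Γ : Subgroup G}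
  {m : Measure (CosetSpace Γ)} {mG : Measure G} [mG.IsHaarMeasure]

/-- A null set downstairs has null preimage by Weil's formula, whereas nonempty open sets of `G`
have positive Haar measure. -/
theorem InducesQuotientMeasure.measure_pos_of_isOpen (hmG : InducesQuotientMeasure mG m)
    {O : Set (CosetSpace Γ)} (hO : IsOpen O) (hne : O.Nonempty) : 0 < m O := by
  have hpre : IsOpen (CosetSpace.mk Γ ⁻¹' O) := hO.preimage CosetSpace.continuous_mk
  have hpos : 0 < mG (CosetSpace.mk Γ ⁻¹' O) :=
    hpre.measure_pos mG (hne.preimage CosetSpace.mk_surjective)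
  rw [pos_iff_ne_zero]
  intro h0
  rw [hmG _ hpre.measurableSet] at hpos
  refine hpos.ne' (lintegral_eq_zero_of_ae_eq_zero ?_)
  have : ∀ᵐ y ∂m, y ∉ O := measure_eq_zero_iff_ae_notMem.1 h0
  filter_upwards [this] with y hy
  have : CosetSpace.mk Γ ⁻¹' O ∩ CosetSpace.mk Γ ⁻¹' {y} = ∅ := by
    rw [eq_empty_iff_forall_notMem]
    rintro x ⟨hx, hxy⟩
    rw [mem_preimage, mem_singleton_iff] at hxy
    exact hy (hxy ▸ hx)
  simp [this]

variable [IsTopologicalGroup G] [SecondCountableTopology G] [LocallyCompactSpace G] [T2Space G]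

/-- If `E ∩ Ω` has `μ`-measure at least `δ`, then many disjoint translates of `S` based at points
of `E` fit into `Z`. -/
theorem InducesQuotientMeasure.sq_mul_le_lintegral_mul [DiscreteTopology Γ]
    [IsProbabilityMeasure m]
    (hmG : InducesQuotientMeasure mG m)
    (hm : ∀ g : G, MeasurePreserving (fun y : CosetSpace Γ => y.mul g) m m)
    (μ : Measure (CosetSpace Γ)) [IsProbabilityMeasure μ]
    {S W : Set G} (hS : MeasurableSet S) (hW : MeasurableSet W) {v : ℝ} (hv : 0 < v)
    (hvS : ENNReal.ofReal v ≤ mG S) {Ω E Z : Set (CosetSpace Γ)} (hZ : MeasurableSet Z)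
    (hinj : ∀ x : G, CosetSpace.mk Γ x ∈ Ω → InjOn (CosetSpace.mk Γ) ((fun b => x * b⁻¹) '' S))
    (hSW : ∀ y y' : CosetSpace Γ, ¬ Disjoint (y.mulSet S) (y'.mulSet S) → y ∈ y'.mulSet W)
    (hEZ : ∀ y ∈ E, y.mulSet S ⊆ Z) {δ : ℝ} (hδ : 0 < δ) (hδE : δ ≤ μ.real (E ∩ Ω)) :
    (δ / 2) ^ 2 * v ≤ (∫⁻ y in Ω, μ (y.mulSet W) ∂μ).toReal * m.real Z := by
  set f : CosetSpace Γ → ℝ≥0∞ := fun y => μ (y.mulSet W) with hf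
  have hfm : Measurable f := CosetSpace.measurable_measure_mulSet μ hW
  set I := ∫⁻ y in Ω, f y ∂μ with hI
  have hI1 : I ≤ 1 := by
    calc I ≤ ∫⁻ y in Ω, 1 ∂μ := lintegral_mono fun y => prob_le_one
      _ = μ Ω := by simp
      _ ≤ 1 := prob_le_one
  have hItop : I ≠ ∞ := ne_top_of_le_ne_top ENNReal.one_ne_top hI1
  have hS0 : 0 < mG S := lt_of_lt_of_le (ENNReal.ofReal_pos.2 hv) hvS
  -- The cutoff `c` for `μ(y W)` exceeds `2 I / δ`, so Markov's inequality discards less than `δ /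
  -- 2`. It is kept strictly above, hence positive even when `I = 0`, and the limit is taken
  -- afterwards.
  have key : ∀ c : ℝ, 2 * I.toReal / δ < c → δ / 2 * v ≤ c * m.real Z := by
    intro c hc
    have hc0 : 0 < c := lt_of_le_of_lt (by positivity) hc
    let A : Set (CosetSpace Γ) := {y | y ∈ E ∩ Ω ∧ f y < ENNReal.ofReal c}
    obtain ⟨T, hTA, hTd, hTmax⟩ := hmG.exists_maximal_disjoint hm hS hS0 (A := A)
      fun x hx => hinj x hx.1.2
    have hcard := hmG.card_mul_le hm hS T hZ (fun x hx => hinj x (hTA hx).1.2) hTd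
      fun y hy => hEZ y (hTA hy).1.1
    have hcard' : T.card * v ≤ m.real Z := by
      have h1 : (T.card : ℝ≥0∞) * ENNReal.ofReal v ≤ m Z :=
        (mul_le_mul_right hvS _).trans hcard
      have h2 := ENNReal.toReal_mono (measure_ne_top m Z) h1
      rwa [ENNReal.toReal_mul, ENNReal.toReal_natCast, ENNReal.toReal_ofReal hv.le] at h2
    have hcover : μ.real A ≤ T.card * c := by
      have h1 : A ⊆ ⋃ y ∈ T, y.mulSet W := by
        intro y hy
        obtain ⟨y', hy', h⟩ := hTmax y hy
        exact mem_biUnion hy' (hSW y y' h)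
      refine (measureReal_mono h1 (measure_ne_top _ _)).trans
        ((measureReal_biUnion_finset_le _ _).trans ?_)
      rw [← nsmul_eq_mul]
      refine Finset.sum_le_card_nsmul _ _ _ fun y hy => ?_
      exact ENNReal.toReal_le_of_le_ofReal hc0.le (hTA hy).2.le
    have hmarkov : μ.real (Ω ∩ {y | ENNReal.ofReal c ≤ f y}) ≤ I.toReal / c := by
      have h1 := meas_ge_le_lintegral_div (μ := μ.restrict Ω) hfm.aemeasurable
        (ENNReal.ofReal_pos.2 hc0).ne' ENNReal.ofReal_ne_top
      rw [Measure.restrict_apply (measurableSet_le measurable_const hfm), inter_comm] at h1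
      have h2 := ENNReal.toReal_mono
        (ENNReal.div_ne_top hItop (ENNReal.ofReal_pos.2 hc0).ne') h1
      rwa [ENNReal.toReal_div, ENNReal.toReal_ofReal hc0.le] at h2
    have hsplit : μ.real (E ∩ Ω) ≤ μ.real A + μ.real (Ω ∩ {y | ENNReal.ofReal c ≤ f y}) := by
      refine (measureReal_mono ?_ (measure_ne_top _ _)).trans (measureReal_union_le _ _)
      intro y hy
      rcases lt_or_ge (f y) (ENNReal.ofReal c) with h | h
      · exact Or.inl ⟨hy, h⟩
      · exact Or.inr ⟨hy.2, h⟩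
    have hIc : I.toReal / c < δ / 2 := by
      rw [div_lt_iff₀ hδ] at hc
      rw [div_lt_iff₀ hc0]
      linarith
    have h3 : δ / 2 ≤ T.card * c := by linarith
    calc δ / 2 * v ≤ T.card * c * v := mul_le_mul_of_nonneg_right h3 hv.le
      _ = c * (T.card * v) := by ring
      _ ≤ c * m.real Z := mul_le_mul_of_nonneg_left hcard' hc0.le
  have hlim : δ / 2 * v ≤ 2 * I.toReal / δ * m.real Z := by
    refine le_of_forall_pos_le_add fun ε hε => ?_
    have h1 := key (2 * I.toReal / δ + ε) (by linarith)
    have h2 : m.real Z ≤ 1 := measureReal_le_one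
    nlinarith
  have h4 : 2 * I.toReal / δ * m.real Z * (δ / 2) = I.toReal * m.real Z := by
    field_simp
  nlinarith [mul_le_mul_of_nonneg_right hlim (by linarith : 0 ≤ δ / 2)]

end Covering

/-! ### The effective bound -/

/-- If `f ≤ 1` has mean `p`, then `f` is at least `(p - (1 - κ)) / κ` outside of a set of measure
at most `κ`. -/
theorem one_sub_le_measureReal_of_integral {α : Type*} [MeasurableSpace α] {μ : Measure α}
    [IsProbabilityMeasure μ] {f : α → ℝ} (hf : Measurable f) (hf01 : ∀ x, f x ∈ Icc (0 : ℝ) 1)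
    {κ : ℝ} (hκ : 0 < κ) (hp : ∫ x, f x ∂μ < 1) :
    1 - κ ≤ μ.real {x | (∫ x, f x ∂μ - (1 - κ)) / κ ≤ f x} := by
  set p := ∫ x, f x ∂μ with hpdef
  set η := (p - (1 - κ)) / κ with hη
  have hηκ : η * κ = p - (1 - κ) := div_mul_cancel₀ _ hκ.ne'
  have hη1 : η < 1 := by rw [hη, div_lt_one hκ]; linarith
  set E := {x | η ≤ f x} with hE
  have hEm : MeasurableSet E := measurableSet_le measurable_const hf
  have hfi : Integrable f μ := Integrable.of_bound hf.aestronglyMeasurable 1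
    (Filter.Eventually.of_forall fun x => by
      rw [Real.norm_eq_abs, abs_le]; constructor <;> linarith [(hf01 x).1, (hf01 x).2])
  -- Markov's inequality for `1 - f`: the level `η` is chosen so that `(1 - η) κ = 1 - p`.
  have h1 : ∀ x, f x ≤ η + E.indicator (fun _ => 1 - η) x := by
    intro x
    by_cases hx : x ∈ E
    · rw [indicator_of_mem hx]; linarith [(hf01 x).2]
    · rw [indicator_of_notMem hx, add_zero]
      exact (not_le.1 hx).le
  have hind : Integrable (E.indicator fun _ => 1 - η) μ :=
    (integrable_const (1 - η)).indicator hEm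
  have h2 := integral_mono hfi ((integrable_const η).add hind) h1
  have h3 : ∫ x, (η + E.indicator (fun _ => 1 - η) x) ∂μ = η + μ.real E * (1 - η) := by
    rw [integral_add (integrable_const η) hind, integral_indicator_const _ hEm]
    simp
  have h4 : p ≤ η + μ.real E * (1 - η) := h2.trans_eq h3
  by_contra! hcon
  nlinarith

section Main

variable {G : Type*} [Group G] [TopologicalSpace G] [IsTopologicalGroup G]
  [SecondCountableTopology G] [LocallyCompactSpace G] [T2Space G]
  [MeasurableSpace G] [BorelSpace G]

/-- The product of the covering lower bound and the large deviation upper bound: the entropy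
deficit controls the deviation of `∫ φ ∂μ`. -/
theorem sq_mul_exp_le_of_lowerSemicontinuous
    (Γ : Subgroup G) [DiscreteTopology Γ]
    (m : Measure (CosetSpace Γ)) [IsProbabilityMeasure m]
    (hm : ∀ g : G, MeasurePreserving (fun y : CosetSpace Γ => y.mul g) m m)
    (mG : Measure G) [mG.IsHaarMeasure] (hmG : InducesQuotientMeasure mG m)
    (a : G) (B : Set G) (hBm : MeasurableSet B) (Ω : Set (CosetSpace Γ))
    (μ : Measure (CosetSpace Γ)) [IsProbabilityMeasure μ]
    (hμ : MeasurePreserving (fun y : CosetSpace Γ => y.mul a⁻¹) μ μ)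
    (s t : ℤ) (hs : s ≤ 0) (ht : 0 ≤ t) (h : ℝ)
    (B₀ : Set G) (hB₀m : MeasurableSet B₀) (hB₀0 : mG.restrict B₀ ≠ 0)
    (C : ℝ) (hC : IsHomogeneousWith mG a h B₀ C)
    (hB₀B : ∀ x ∈ B₀, ∀ y ∈ B₀, x⁻¹ * y ∈ B)
    (hinj : ∀ x : G, CosetSpace.mk Γ x ∈ Ω →
      Set.InjOn (CosetSpace.mk Γ) ((fun b => x * b⁻¹) '' B₀))
    (φ : CosetSpace Γ → ℝ) (hφ : ∀ y, φ y ∈ Set.Icc (0 : ℝ) 1) (hφl : LowerSemicontinuous φ)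
    (hp1 : ∫ y, φ y ∂μ < 1) {κ : ℝ} (hκ0 : 0 < κ) (hκ : κ < μ.real Ω)
    {n : ℕ} (hn : (n : ℤ) = t - s + 1) :
    ((μ.real Ω - κ) / 2) ^ 2 * (C * Real.exp (-h * n)) ≤
      (∫⁻ y in Ω, μ (y.mulSet (bowenBall a B s t)) ∂μ).toReal *
        m.real {z | (∫ y, φ y ∂μ - (1 - κ)) / κ * n ≤ ∑ i ∈ Finset.range n,
          upperEnvelope mG B₀ φ ((fun y : CosetSpace Γ => y.mul a⁻¹)^[i] z)} := by
  have hrinv := hmG.isMulRightInvariant hm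
  set ψ := upperEnvelope mG B₀ φ with hψ
  have hψl : LowerSemicontinuous ψ := lowerSemicontinuous_upperEnvelope hB₀0 hφl hφ
  set η := (∫ y, φ y ∂μ - (1 - κ)) / κ with hη
  set σ : CosetSpace Γ → CosetSpace Γ := fun y => y.mul a⁻¹ with hσ
  -- The shift by `a^{-s}` turns the times `s, …, t` into `0, …, n - 1`.
  set τ : CosetSpace Γ → CosetSpace Γ := fun y => y.mul (a ^ (-s)) with hτ
  have hστ : ∀ (i : ℕ) (y : CosetSpace Γ), σ^[i] (τ y) = y.mul (a ^ (-(s + i))) := by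
    intro i y
    rw [hσ, hτ, CosetSpace.iterate_mul, CosetSpace.mul_mul]
    congr 1
    group
  have hσμ : MeasurePreserving σ μ μ := hμ
  have hτμ : MeasurePreserving τ μ μ := by
    obtain ⟨l, hl⟩ : ∃ l : ℕ, -s = l := ⟨(-s).toNat, by omega⟩
    have h1 := (CosetSpace.measurePreserving_mul_inv hμ).iterate l
    rw [inv_inv] at h1
    convert h1 using 1
    funext y
    rw [CosetSpace.iterate_mul, hτ, hl, zpow_natCast]
  have hn0 : (0 : ℝ) < n := by
    have : 0 < n := by omega
    exact_mod_cast this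
  -- the part of `B₀` of full measure which supports Haar measure
  set B₁ := B₀ ∩ (mG.restrict B₀).support with hB₁
  have hB₁m : MeasurableSet B₁ := hB₀m.inter Measure.isClosed_support.measurableSet
  have hdiff : mG (B₀ \ B₁) = 0 := by
    have h1 : B₀ \ B₁ = (mG.restrict B₀).supportᶜ ∩ B₀ := by
      ext x; simp only [hB₁, mem_sdiff, mem_inter_iff, mem_compl_iff]; tauto
    rw [h1, ← Measure.restrict_apply Measure.isClosed_support.measurableSet.compl]
    exact Measure.measure_compl_support
  have hvS : ENNReal.ofReal (C * Real.exp (-h * n)) ≤ mG (bowenBall a B₁ s t) := by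
    refine le_trans ?_ (measure_bowenBall_le_of_null_diff mG a hdiff s t)
    have h1 := hC.2 s t hs ht
    have h2 : ((t : ℝ) - s + 1) = n := by exact_mod_cast hn.symm
    rwa [h2] at h1
  -- Time `0` lies in `[s, t]`, so injectivity on translates of `B₀` passes to the Bowen ball.
  have hsub : bowenBall a B₁ s t ⊆ B₀ := by
    intro x hx
    have h1 := mem_bowenBall.1 hx 0 ⟨hs, ht⟩
    have h2 : a ^ (0 : ℤ) * x * a ^ (-(0 : ℤ)) = x := by simp
    rw [h2] at h1
    exact h1.1
  -- the orbits with large average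
  set f : CosetSpace Γ → ℝ := fun y => (∑ i ∈ Finset.range n, φ (σ^[i] (τ y))) / n with hf
  have hφm : Measurable φ := hφl.measurable
  have hsm : ∀ i, MeasurePreserving (fun y => σ^[i] (τ y)) μ μ := fun i =>
    (hσμ.iterate i).comp hτμ
  have hfm : Measurable f :=
    (Finset.measurable_sum _ fun i _ => hφm.comp (hsm i).measurable).div_const _
  have hf01 : ∀ y, f y ∈ Icc (0 : ℝ) 1 := by
    intro y
    refine ⟨div_nonneg (Finset.sum_nonneg fun i _ => (hφ _).1) hn0.le, ?_⟩
    rw [div_le_one hn0]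
    refine (Finset.sum_le_sum fun i _ => (hφ (σ^[i] (τ y))).2).trans ?_
    simp
  have hφi : Integrable φ μ := Integrable.of_bound hφm.aestronglyMeasurable 1
    (Filter.Eventually.of_forall fun x => by
      rw [Real.norm_eq_abs, abs_le]; constructor <;> linarith [(hφ x).1, (hφ x).2])
  have hfint : ∫ y, f y ∂μ = ∫ y, φ y ∂μ := by
    have h1 : ∀ i, ∫ y, φ (σ^[i] (τ y)) ∂μ = ∫ y, φ y ∂μ := by
      intro i
      have h2 := integral_map (μ := μ) (hsm i).measurable.aemeasurable
        (f := φ) hφm.aestronglyMeasurable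
      rw [(hsm i).map_eq] at h2
      exact h2.symm
    have h3 : ∀ i ∈ Finset.range n, Integrable (fun y => φ (σ^[i] (τ y))) μ := fun i _ =>
      (hsm i).integrable_comp_of_integrable hφi
    rw [hf, integral_div, integral_finsetSum _ h3]
    simp only [h1, Finset.sum_const, Finset.card_range, nsmul_eq_mul]
    rw [mul_div_cancel_left₀ _ hn0.ne']
  have hmeasE := one_sub_le_measureReal_of_integral hfm hf01 hκ0 (by rwa [hfint])
  rw [hfint, ← hη] at hmeasE
  set E := {y | η ≤ f y} with hE
  have hδE : μ.real Ω - κ ≤ μ.real (E ∩ Ω) := by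
    have h1 : μ.real Ω ≤ μ.real (E ∩ Ω) + μ.real Eᶜ := by
      refine (measureReal_mono (fun y hy => ?_) (measure_ne_top _ _)).trans
        (measureReal_union_le _ _)
      by_cases hyE : y ∈ E
      · exact Or.inl ⟨hyE, hy⟩
      · exact Or.inr hyE
    rw [probReal_compl_eq_one_sub (measurableSet_le measurable_const hfm)] at h1
    linarith
  set Z₀ := {z | η * n ≤ ∑ i ∈ Finset.range n, ψ (σ^[i] z)} with hZ₀
  have hZ₀m : MeasurableSet Z₀ := measurableSet_le measurable_const
    (Finset.measurable_sum _ fun i _ =>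
      hψl.measurable.comp (((hm a⁻¹).iterate i).measurable))
  -- At each time `i` in `[s, t]` the orbit of `y` is the orbit of `z` moved by an element of `B₁`,
  -- so `φ` along the former is at most `ψ` along the latter.
  have hEZ : ∀ y ∈ E, y.mulSet (bowenBall a B₁ s t) ⊆ τ ⁻¹' Z₀ := by
    intro y hy z hz
    have h1 : η * n ≤ ∑ i ∈ Finset.range n, φ (σ^[i] (τ y)) := by
      rw [← le_div_iff₀ hn0]; exact hy
    refine h1.trans (Finset.sum_le_sum fun i hi => ?_)
    have hi' : s + (i : ℤ) ∈ Icc s t := by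
      have := Finset.mem_range.1 hi
      constructor <;> omega
    obtain ⟨c, hc, hcz⟩ := exists_mul_eq_of_mem_mulSet_bowenBall hz hi'
    rw [hστ, hστ, ← hcz]
    exact apply_mul_le_upperEnvelope hφl hφ _ hc.2
  have hfinal := hmG.sq_mul_le_lintegral_mul hm μ (measurableSet_bowenBall a hB₁m s t)
    (measurableSet_bowenBall a hBm s t) (mul_pos hC.1 (Real.exp_pos _)) hvS (Ω := Ω)
    ((hm (a ^ (-s))).measurable hZ₀m)
    (fun x hx => (hinj x hx).mono (image_mono hsub))
    (fun y y' hyy' => mem_mulSet_bowenBall_of_not_disjoint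
      (fun x hx x' hx' => hB₀B x hx.1 x' hx'.1) hyy')
    hEZ (sub_pos.2 hκ) hδE
  have hZ : m.real (τ ⁻¹' Z₀) = m.real Z₀ := by
    rw [measureReal_def, measureReal_def, (hm (a ^ (-s))).measure_preimage hZ₀m.nullMeasurableSet]
  rwa [hZ] at hfinal

/-- The packing and large deviation bounds combine to `(δ/2)² C e^{-hn} ≤ I k e^{-(n/k - 1)
D(η‖q)}`. Taking logarithms, with `log I = -αn`, and dividing by `n (-log λ)` gives the estimate. -/
theorem klTwo_div_le_of_lowerSemicontinuous
    (Γ : Subgroup G) [DiscreteTopology Γ]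
    (m : Measure (CosetSpace Γ)) [IsProbabilityMeasure m]
    (hm : ∀ g : G, MeasurePreserving (fun y : CosetSpace Γ => y.mul g) m m)
    (mG : Measure G) [mG.IsHaarMeasure] (hmG : InducesQuotientMeasure mG m) (K : Subgroup G)
    (a : G) (hM : HasPropertyM (hm a⁻¹) (stateAlgebra_le Γ K))
    (lam : ℝ) (hlam : lam = averagingNorm (hm a⁻¹) (stateAlgebra_le Γ K))
    (hlam0 : 0 < lam) (hlam1 : lam < 1)
    (B : Set G) (hBm : MeasurableSet B) (Ω : Set (CosetSpace Γ))
    (μ : Measure (CosetSpace Γ)) [IsProbabilityMeasure μ]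
    (hμ : MeasurePreserving (fun y : CosetSpace Γ => y.mul a⁻¹) μ μ)
    (s t : ℤ) (hs : s ≤ 0) (ht : 0 ≤ t) (h : ℝ)
    (B₀ : Set G) (hB₀ : B₀ ∈ 𝓝 (1 : G)) (hB₀m : MeasurableSet B₀)
    (hB₀N : B₀ ⊆ (Subgroup.normalizer (K : Set G) : Set G))
    (C : ℝ) (hC : IsHomogeneousWith mG a h B₀ C)
    (hB₀B : ∀ x ∈ B₀, ∀ y ∈ B₀, x⁻¹ * y ∈ B)
    (hinj : ∀ x : G, CosetSpace.mk Γ x ∈ Ω →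
      Set.InjOn (CosetSpace.mk Γ) ((fun b => x * b⁻¹) '' B₀))
    (φ : CosetSpace Γ → ℝ) (hφm : Measurable[stateAlgebra Γ K] φ)
    (hφ : ∀ y, φ y ∈ Set.Icc (0 : ℝ) 1) (hφl : LowerSemicontinuous φ)
    (hp1 : ∫ y, φ y ∂μ < 1)
    (hβp : ∫ y, upperEnvelope mG B₀ φ y ∂m ≤ ∫ y, φ y ∂μ)
    {κ θ : ℝ} (hκ : κ < μ.real Ω)
    (hκ' : (1 - ∫ y, φ y ∂μ) / (1 - ∫ y, upperEnvelope mG B₀ φ y ∂m) ≤ κ)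
    (hθ : ∃ k : ℕ, 1 ≤ k ∧ θ = lam ^ k)
    (hθ' : θ ≤ ((∫ y, φ y ∂μ - (1 - κ)) / κ - ∫ y, upperEnvelope mG B₀ φ y ∂m) /
          (1 - ∫ y, upperEnvelope mG B₀ φ y ∂m)) :
    klTwo ((∫ y, φ y ∂μ - (1 - κ)) / κ)
            (θ + (1 - θ) * ∫ y, upperEnvelope mG B₀ φ y ∂m) / (-Real.log θ) ≤
          (h - bowenRate μ a B Ω s t) / (-Real.log lam) +
            1 / (((t : ℝ) - s + 1) * (-Real.log lam)) *
              (Real.log (Real.log θ / Real.log lam) +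
                klTwo (∫ y, φ y ∂μ) (∫ y, upperEnvelope mG B₀ φ y ∂m) -
                2 * Real.log ((μ.real Ω - κ) / 2) - Real.log C) := by
  obtain ⟨k, hk, hθk⟩ := hθ
  have h1supp : (1 : G) ∈ (mG.restrict B₀).support := by
    rw [Measure.mem_support_iff_forall]
    intro U hU
    exact lt_of_lt_of_le (Measure.measure_pos_of_mem_nhds mG (Filter.inter_mem hU hB₀))
      (Measure.le_restrict_apply _ _)
  have hB₀0 : mG.restrict B₀ ≠ 0 := by
    rw [Ne, Measure.restrict_eq_zero]
    exact (Measure.measure_pos_of_mem_nhds mG hB₀).ne'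
  set ψ := upperEnvelope mG B₀ φ with hψ
  have hψl : LowerSemicontinuous ψ := lowerSemicontinuous_upperEnvelope hB₀0 hφl hφ
  have hψ01 : ∀ y, ψ y ∈ Icc (0 : ℝ) 1 := upperEnvelope_mem_Icc hB₀0 hφ
  have hψK : ∀ y, ∀ k ∈ K, ψ (y.mul k) = ψ y := fun y k hk =>
    upperEnvelope_mul_of_mem hB₀m hB₀N (fun y k hk => eq_of_measurable_stateAlgebra hφm y hk) y hk
  have hψm : Measurable[stateAlgebra Γ K] ψ := hψl.measurable_stateAlgebra hψK
  have hφψ : ∀ y, φ y ≤ ψ y := fun y => by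
    simpa only [CosetSpace.mul_one] using apply_mul_le_upperEnvelope hφl hφ y h1supp
  set p := ∫ y, φ y ∂μ with hp
  set β := ∫ y, ψ y ∂m with hβ
  set η := (p - (1 - κ)) / κ with hη
  have hβ0 : 0 ≤ β := integral_nonneg fun y => (hψ01 y).1
  have hβ1 : β < 1 := hβp.trans_lt hp1
  have hκ0 : 0 < κ := lt_of_lt_of_le (div_pos (by linarith) (by linarith)) hκ'
  have hκ1 : κ < 1 := hκ.trans_le measureReal_le_one
  have hθ0 : 0 < θ := hθk ▸ pow_pos hlam0 k
  have hθ1 : θ < 1 := hθk ▸ pow_lt_one₀ hlam0.le hlam1 (by omega)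
  have hη1 : η < 1 := by rw [hη, div_lt_one hκ0]; linarith
  have hηp : η ≤ p := by rw [hη, div_le_iff₀ hκ0]; nlinarith
  set q := θ + (1 - θ) * β with hq
  -- The upper bound imposed on `θ` is precisely this inequality, the range in which Chernoff's
  -- bound operates.
  have hqη : q ≤ η := by
    rw [le_div_iff₀ (by linarith)] at hθ'
    rw [hq]; linarith
  have hβq : β ≤ q := by rw [hq]; nlinarith
  have hq0 : 0 < q := add_pos_of_pos_of_nonneg hθ0 (mul_nonneg (by linarith) hβ0)
  -- Needed for the divergence from `β`: `φ` is positive somewhere, so `ψ` is positive on a nonempty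
  -- open set.
  have hβpos : 0 < β := by
    have hp0 : 0 < p := by linarith
    obtain ⟨y, hy⟩ : ∃ y, 0 < φ y := by
      by_contra! hcon
      exact absurd hp0 (not_lt.2 (integral_nonpos hcon))
    have hO := hmG.measure_pos_of_isOpen (hψl.isOpen_preimage 0) ⟨y, hy.trans_le (hφψ y)⟩
    have hψi : Integrable ψ m := Integrable.of_bound hψl.measurable.aestronglyMeasurable 1
      (Filter.Eventually.of_forall fun x => by
        rw [Real.norm_eq_abs, abs_le]; constructor <;> linarith [(hψ01 x).1, (hψ01 x).2])
    rw [hβ, integral_pos_iff_support_of_nonneg (fun y => (hψ01 y).1) hψi]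
    exact hO.trans_le (measure_mono fun y hy => ne_of_gt hy)
  obtain ⟨n, hn⟩ : ∃ n : ℕ, (n : ℤ) = t - s + 1 := ⟨(t - s + 1).toNat, by omega⟩
  have hnR : (t : ℝ) - s + 1 = n := by exact_mod_cast hn.symm
  have hn0 : (0 : ℝ) < n := by
    have : 0 < n := by omega
    exact_mod_cast this
  have hlower := sq_mul_exp_le_of_lowerSemicontinuous Γ m hm mG hmG a B hBm Ω μ hμ s t hs ht h
    B₀ hB₀m hB₀0 C hC hB₀B hinj φ hφ hφl hp1 hκ0 hκ hn
  have hupper := measureReal_orbit_sum_ge_le (hm a⁻¹) (stateAlgebra_le Γ K) hM hψm hψ01 hk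
    (hθk.trans (by rw [hlam])) hθ0 (hlam ▸ hlam1) hη1 hqη n
  rw [← hp, ← hη, ← hψ] at hlower
  rw [← hβ, ← hq] at hupper
  set I := (∫⁻ y in Ω, μ (y.mulSet (bowenBall a B s t)) ∂μ).toReal with hI
  set δ := μ.real Ω - κ with hδ
  have hδ0 : 0 < δ := sub_pos.2 hκ
  have hI0 : 0 ≤ I := ENNReal.toReal_nonneg
  have hk0 : (0 : ℝ) < k := by exact_mod_cast hk
  have hprod := hlower.trans (mul_le_mul_of_nonneg_left hupper hI0)
  have hLpos : 0 < (δ / 2) ^ 2 * (C * Real.exp (-h * n)) :=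
    mul_pos (by positivity) (mul_pos hC.1 (Real.exp_pos _))
  -- The lower bound is positive, so `I` cannot vanish and `log I` is meaningful.
  have hIpos : 0 < I := by
    refine hI0.lt_of_ne fun h0 => ?_
    rw [← h0, zero_mul] at hprod
    linarith
  have hlog := Real.log_le_log hLpos hprod
  rw [Real.log_mul (by positivity) (mul_pos hC.1 (Real.exp_pos _)).ne', Real.log_pow,
    Real.log_mul hC.1.ne' (Real.exp_pos _).ne', Real.log_exp, Real.log_mul hIpos.ne'
      (mul_pos hk0 (Real.exp_pos _)).ne', Real.log_mul hk0.ne' (Real.exp_pos _).ne',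
    Real.log_exp] at hlog
  push_cast at hlog
  have hrate : bowenRate μ a B Ω s t = -(1 / n) * Real.log I := by rw [bowenRate, hnR]
  -- Absorbs the `D(η‖q)` produced by the `-1` in `n / k - 1`, using `β ≤ q ≤ η ≤ p`.
  have hmono : klTwo η q ≤ klTwo p β := klTwo_mono hp1 hβpos hβq hqη hηp
  have hloglam : 0 < -Real.log lam := neg_pos.2 (Real.log_neg hlam0 hlam1)
  have hlogθ : -Real.log θ = k * -Real.log lam := by rw [hθk, Real.log_pow]; ring
  have hlogk : Real.log θ / Real.log lam = k := by
    rw [hθk, Real.log_pow, mul_div_cancel_right₀ _ (by linarith)]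
  rw [hlogk, hlogθ, hrate, hnR]
  have hcore : klTwo η q * (n / k) ≤ (h - -(1 / n) * Real.log I) * n +
      (Real.log k + klTwo p β - 2 * Real.log (δ / 2) - Real.log C) := by
    have h1 : (h - -(1 / n) * Real.log I) * n = h * n + Real.log I := by
      field_simp
      ring
    rw [h1]
    have h2 : (n / k - 1) * klTwo η q = klTwo η q * (n / k) - klTwo η q := by ring
    linarith
  have hmul := mul_le_mul_of_nonneg_left hcore
    (div_nonneg zero_le_one (mul_pos hn0 hloglam).le : 0 ≤ 1 / (n * -Real.log lam))
  set L := -Real.log lam with hL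
  calc klTwo η q / (k * L) = 1 / (n * L) * (klTwo η q * (n / k)) := by
        field_simp
    _ ≤ _ := hmul
    _ = _ := by
        field_simp

end Main

/-! ### Lower- and upper-semicontinuous test functions -/

theorem mainTheorem4 {G : Type*} [Group G] [TopologicalSpace G] [IsTopologicalGroup G]
    [SecondCountableTopology G] [LocallyCompactSpace G] [T2Space G]
    [MeasurableSpace G] [BorelSpace G]
    -- the lattice `Γ`, the invariant probability measure `m` on `Γ \ G`, the Haar measure of `G`
    (Γ : Subgroup G) [DiscreteTopology Γ]
    (m : Measure (CosetSpace Γ)) [IsProbabilityMeasure m]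
    (hm : ∀ g : G, MeasurePreserving (fun y : CosetSpace Γ => y.mul g) m m)
    (mG : Measure G) [mG.IsHaarMeasure] (hmG : InducesQuotientMeasure mG m)
    -- the compact subgroup `K`
    (K : Subgroup G) (hK : IsCompact (K : Set G))
    (hNK : IsOpen (Subgroup.normalizer (K : Set G) : Set G))
    -- the right action by `a`, with property (M), and the norm of the averaging operator
    (a : G) (hM : HasPropertyM (hm a⁻¹) (stateAlgebra_le Γ K))
    (lam : ℝ) (hlam : lam = averagingNorm (hm a⁻¹) (stateAlgebra_le Γ K))
    (hlam0 : 0 < lam) (hlam1 : lam < 1)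
    (B : Set G) (hB : B ∈ 𝓝 (1 : G)) (hBm : MeasurableSet B)
    (Ω : Set (CosetSpace Γ)) (hΩ : IsCompact Ω)
    (μ : Measure (CosetSpace Γ)) [IsProbabilityMeasure μ]
    (hμ : MeasurePreserving (fun y : CosetSpace Γ => y.mul a⁻¹) μ μ)
    (s t : ℤ) (hs : s ≤ 0) (ht : 0 ≤ t) (hst : s ≠ t)
    (h : ℝ) (hh : 0 < h)
    (B₀ : Set G) (hB₀ : B₀ ∈ 𝓝 (1 : G)) (hB₀m : MeasurableSet B₀)
    (hB₀N : B₀ ⊆ (Subgroup.normalizer (K : Set G) : Set G))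
    (C : ℝ) (hC : IsHomogeneousWith mG a h B₀ C)
    (hB₀B : ∀ x ∈ B₀, ∀ y ∈ B₀, x⁻¹ * y ∈ B)
    (hinj : ∀ x : G, CosetSpace.mk Γ x ∈ Ω →
      Set.InjOn (CosetSpace.mk Γ) ((fun b => x * b⁻¹) '' B₀))
    (φ : CosetSpace Γ → ℝ) (hφm : Measurable[stateAlgebra Γ K] φ)
    (hφ : ∀ y, φ y ∈ Set.Icc (0 : ℝ) 1) :
    (LowerSemicontinuous φ →
      ∫ y, φ y ∂μ < 1 →
      ∫ y, upperEnvelope mG B₀ φ y ∂m ≤ ∫ y, φ y ∂μ →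
      ∀ κ θ : ℝ,
        κ < μ.real Ω →
        (1 - ∫ y, φ y ∂μ) / (1 - ∫ y, upperEnvelope mG B₀ φ y ∂m) ≤ κ →
        (∃ k : ℕ, 1 ≤ k ∧ θ = lam ^ k) →
        θ ≤ ((∫ y, φ y ∂μ - (1 - κ)) / κ - ∫ y, upperEnvelope mG B₀ φ y ∂m) /
          (1 - ∫ y, upperEnvelope mG B₀ φ y ∂m) →
        klTwo ((∫ y, φ y ∂μ - (1 - κ)) / κ)
            (θ + (1 - θ) * ∫ y, upperEnvelope mG B₀ φ y ∂m) / (-Real.log θ) ≤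
          (h - bowenRate μ a B Ω s t) / (-Real.log lam) +
            1 / (((t : ℝ) - s + 1) * (-Real.log lam)) *
              (Real.log (Real.log θ / Real.log lam) +
                klTwo (∫ y, φ y ∂μ) (∫ y, upperEnvelope mG B₀ φ y ∂m) -
                2 * Real.log ((μ.real Ω - κ) / 2) - Real.log C)) ∧
    (UpperSemicontinuous φ →
      0 < ∫ y, φ y ∂μ →
      ∫ y, φ y ∂μ ≤ ∫ y, lowerEnvelope mG B₀ φ y ∂m →
      ∀ κ θ : ℝ,
        κ < μ.real Ω →
        (∫ y, φ y ∂μ) / (∫ y, lowerEnvelope mG B₀ φ y ∂m) ≤ κ →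
        (∃ k : ℕ, 1 ≤ k ∧ θ = lam ^ k) →
        θ ≤ (∫ y, lowerEnvelope mG B₀ φ y ∂m - (∫ y, φ y ∂μ) / κ) /
          (∫ y, lowerEnvelope mG B₀ φ y ∂m) →
        klTwo ((∫ y, φ y ∂μ) / κ)
            ((1 - θ) * ∫ y, lowerEnvelope mG B₀ φ y ∂m) / (-Real.log θ) ≤
          (h - bowenRate μ a B Ω s t) / (-Real.log lam) +
            1 / (((t : ℝ) - s + 1) * (-Real.log lam)) *
              (Real.log (Real.log θ / Real.log lam) +
                klTwo (∫ y, φ y ∂μ) (∫ y, lowerEnvelope mG B₀ φ y ∂m) -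
                2 * Real.log ((μ.real Ω - κ) / 2) - Real.log C)) := by
  have hB₀0 : mG.restrict B₀ ≠ 0 := by
    rw [Ne, Measure.restrict_eq_zero]
    exact (Measure.measure_pos_of_mem_nhds mG hB₀).ne'
  refine ⟨fun hφl hp1 hβp κ θ hκ hκ' hθ hθ' => klTwo_div_le_of_lowerSemicontinuous Γ m hm mG hmG K a
    hM lam hlam hlam0 hlam1 B hBm Ω μ hμ s t hs ht h B₀ hB₀ hB₀m hB₀N C hC hB₀B hinj φ hφm hφ
    hφl hp1 hβp hκ hκ' hθ hθ', ?_⟩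
  intro hφu hp0 hpβ κ θ hκ hκ' hθ hθ'
  -- The reflection `1 - φ` is lower-semicontinuous and exchanges essential infimum and supremum,
  -- and the divergence is unchanged when both arguments are replaced by their complements.
  set φ' : CosetSpace Γ → ℝ := fun y => 1 - φ y with hφ'
  have hφ'01 : ∀ y, φ' y ∈ Icc (0 : ℝ) 1 := fun y =>
    ⟨by simp only [hφ']; linarith [(hφ y).2], by simp only [hφ']; linarith [(hφ y).1]⟩
  have hφ'm : Measurable[stateAlgebra Γ K] φ' := measurable_const.sub hφm
  have hφ'l : LowerSemicontinuous φ' := by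
    intro y c hc
    filter_upwards [hφu y (1 - c) (by simp only [hφ'] at hc; linarith)] with z hz
    simp only [hφ']
    linarith
  have hint : ∀ {ν : Measure (CosetSpace Γ)} [IsProbabilityMeasure ν] {f : CosetSpace Γ → ℝ},
      Measurable f → (∀ y, f y ∈ Icc (0 : ℝ) 1) → ∫ y, (1 - f y) ∂ν = 1 - ∫ y, f y ∂ν := by
    intro ν _ f hf hf01
    rw [integral_sub (integrable_const 1) (Integrable.of_bound hf.aestronglyMeasurable 1
      (Filter.Eventually.of_forall fun x => by
        rw [Real.norm_eq_abs, abs_le]; constructor <;> linarith [(hf01 x).1, (hf01 x).2]))]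
    simp
  have hp' : ∫ y, φ' y ∂μ = 1 - ∫ y, φ y ∂μ := hint (hφm.mono (stateAlgebra_le Γ K) le_rfl) hφ
  have hβ' : ∫ y, upperEnvelope mG B₀ φ' y ∂m = 1 - ∫ y, lowerEnvelope mG B₀ φ y ∂m := by
    simp only [lowerEnvelope_eq_one_sub hB₀0 hφ]
    rw [hint (lowerSemicontinuous_upperEnvelope hB₀0 hφ'l hφ'01).measurable
      (upperEnvelope_mem_Icc hB₀0 hφ'01), sub_sub_cancel]
  set p := ∫ y, φ y ∂μ with hp
  set β := ∫ y, lowerEnvelope mG B₀ φ y ∂m with hβ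
  have hβ0 : 0 < β := hp0.trans_le hpβ
  have hκ0 : 0 < κ := (div_pos hp0 hβ0).trans_le hκ'
  have hη : (1 - p - (1 - κ)) / κ = 1 - p / κ := by
    field_simp
    ring
  have hmain := klTwo_div_le_of_lowerSemicontinuous Γ m hm mG hmG K a hM lam hlam hlam0 hlam1 B hBm
    Ω μ hμ s t hs ht h B₀ hB₀ hB₀m hB₀N C hC hB₀B hinj φ' hφ'm hφ'01 hφ'l
    (κ := κ) (θ := θ) (by rw [hp']; linarith) (by rw [hp', hβ']; linarith) hκ
    (by rw [hp', hβ', sub_sub_cancel, sub_sub_cancel]; exact hκ') hθ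
    (by
      rw [hp', hβ', hη, sub_sub_cancel]
      refine hθ'.trans (le_of_eq ?_)
      ring)
  rw [hp', hβ', hη, klTwo_one_sub] at hmain
  have hq : θ + (1 - θ) * (1 - β) = 1 - (1 - θ) * β := by ring
  rwa [hq, klTwo_one_sub] at hmain
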